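/- Let $N\ge 2$ be an integer and let $\Upsilon\subset\mathbb R^N$ be a bounded open set of (Euclidean) diameter $h$. Suppose that $\Upsilon$ is star-shaped with respect to the open ball $B=B_{\rho h}(y)\subset\Upsilon$ with centre $y\in\Upsilon$ and radius $\rho h$, where $0<\rho\le 1/2$; that is, for all $a\in\Upsilon$ and $b\in B$ the segment from $a$ to $b$ lies in $\Upsilon$. Let $N',N'',d\in\mathbb N$ and let $\mathcal L$ be a linear differential operator with constant real coefficients, homogeneous of degree $d$, acting on $\mathbb R^{N'}$-valued fields with values in $\mathbb R^{N''}$: $$(\mathcal L u)_{i''}=\sum_{i'=1}^{N'}\ \sum_{\alpha\in\mathbb N_0^N,\ |\alpha|=d}a_{\alpha,i',i''}\,D^\alpha u_{i'},\qquad i''=1,\dots,N''.$$ Let $u\in L^2(\Upsilon)^{N'}$ be a distributional solution of $\mathcal L u=0$ in $\Upsilon$, and let $m\ge1$ be an integer. Write $$T^m_{z}[u](x)=\sum_{|\alpha|<m}\frac1{\alpha!}D^\alpha u(z)\,(x-z)^\alpha$$ for the Taylor polynomial of order $m$ of $u$ at $z$, and $$Q^m[u](x)=\frac1{|B|}\int_B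 T^m_z[u](x)\,dz$$ for the averaged Taylor polynomial, in which the derivatives of $u$ are weak derivatives. Let $|v|_{H^j(\Upsilon)^{N'}}=\big(\sum_{i=1}^{N'}\sum_{|\alpha|=j}\|D^\alpha v_i\|_{L^2(\Upsilon)}^2\big)^{1/2}$. (i) If $u\in C^{m-1}(\Upsilon)^{N'}$, then for every $z\in\Upsilon$ (in particular for $z=y$) the Taylor polynomial $T^m_z[u]$, which has degree at most $m-1$, satisfies $\mathcal L(T^m_z[u])=0$ in $\mathbb R^N$. (ii) If $u\in H^{m-1}(\Upsilon)^{N'}$, then the integral defining $Q^m[u](x)$ converges absolutely for every $x$, $Q^m[u]$ is a polynomial of degree at most $m-1$, and $\mathcal L(Q^m[u])=0$ in $\mathbb R^N$. (iii) If $u\in H^{m}(\Upsilon)^{N'}$, then $u-Q^m[u]\in H^m(\Upsilon)^{N'}$ and, for all integers $0\le j\le m-1$, $$|u-Q^m[u]|_{H^j(\Upsilon)^{N'}}\le 2\binom{N+j-1}{N-1}\frac{N^{m-j}}{(m-j-1)!}\,\frac{h^{m-j}}{\rho^{N/2}}\,|u|_{H^m(\Upsilon)^{N'}}.$$ -/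

import Mathlib

open MeasureTheory
open scoped ContDiff Nat

namespace AveragedTaylor

/-- The Euclidean space `ℝ^N`. -/
abbrev E (N : ℕ) : Type := EuclideanSpace ℝ (Fin N)

/-- Multi-indices `α ∈ ℕ₀^N`. -/
abbrev MultiIndex (N : ℕ) : Type := Fin N → ℕ

/-- The length `|α|` of a multi-index. -/
def MultiIndex.length {N : ℕ} (α : MultiIndex N) : ℕ := ∑ i, α i

/-- The factorial `α! = α₁! ⋯ α_N!` of a multi-index. -/
def MultiIndex.fact {N : ℕ} (α : MultiIndex N) : ℕ := ∏ i, (α i)!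

/-- The monomial `x^α = x₁^{α₁} ⋯ x_N^{α_N}`. -/
def monomial {N : ℕ} (α : MultiIndex N) (x : E N) : ℝ := ∏ i, x i ^ α i

/-- The finite set of all multi-indices of length `k`. -/
def multiIndices (N k : ℕ) : Finset (MultiIndex N) := Finset.piAntidiag Finset.univ k

theorem mem_multiIndices {N k : ℕ} {α : MultiIndex N} :
    α ∈ multiIndices N k ↔ MultiIndex.length α = k := by
  simp [multiIndices, MultiIndex.length]

/-- The classical partial derivative `∂f/∂x_i`. -/
noncomputable def partialDeriv {N : ℕ} (i : Fin N) (f : E N → ℝ) : E N → ℝ :=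
  fun x => lineDeriv ℝ f x (EuclideanSpace.single i 1)

/-- The classical derivative `D^α f = ∂₁^{α₁} ⋯ ∂_N^{α_N} f`. -/
noncomputable def classicalDeriv {N : ℕ} (α : MultiIndex N) (f : E N → ℝ) : E N → ℝ :=
  (List.finRange N).foldr (fun i g => (partialDeriv i)^[α i] g) f

/-- Test functions: smooth real functions with compact support contained in `Υ`. -/
def IsTestFunction {N : ℕ} (Υ : Set (E N)) (η : E N → ℝ) : Prop :=
  ContDiff ℝ ∞ η ∧ HasCompactSupport η ∧ tsupport η ⊆ Υ

/-- `g` is a weak derivative `D^α v` on the open set `Υ`. -/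
def HasWeakDeriv {N : ℕ} (Υ : Set (E N)) (α : MultiIndex N) (v g : E N → ℝ) : Prop :=
  LocallyIntegrableOn v Υ ∧ LocallyIntegrableOn g Υ ∧
    ∀ η : E N → ℝ, IsTestFunction Υ η →
      ∫ x in Υ, v x * classicalDeriv α η x
        = (-1) ^ MultiIndex.length α * ∫ x in Υ, g x * η x

open Classical in
/-- A representative of the weak derivative `D^α v` on `Υ` (unique up to a null set); it is `0` by
convention when there is no weak derivative. -/
noncomputable def weakDeriv {N : ℕ} (Υ : Set (E N)) (α : MultiIndex N) (v : E N → ℝ) :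
    E N → ℝ :=
  if h : ∃ g, HasWeakDeriv Υ α v g then h.choose else 0

/-- `v ∈ L²(Υ)^{N'}`. -/
def MemL2 {N N' : ℕ} (Υ : Set (E N)) (v : Fin N' → E N → ℝ) : Prop :=
  ∀ i, MemLp (v i) 2 (volume.restrict Υ)

/-- `v ∈ H^k(Υ)^{N'}`: every component is in `L²(Υ)` and has weak derivatives in `L²(Υ)` of all
orders up to `k`. -/
def MemH {N N' : ℕ} (Υ : Set (E N)) (k : ℕ) (v : Fin N' → E N → ℝ) : Prop :=
  MemL2 Υ v ∧ ∀ i, ∀ α : MultiIndex N, MultiIndex.length α ≤ k →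
    ∃ g, HasWeakDeriv Υ α (v i) g ∧ MemLp g 2 (volume.restrict Υ)

/-- The seminorm `|v|_{H^j(Υ)^{N'}} = (∑_{i} ∑_{|α| = j} ‖D^α v_i‖²_{L²(Υ)})^{1/2}`,
for `v ∈ H^j(Υ)^{N'}`. -/
noncomputable def seminormH {N N' : ℕ} (Υ : Set (E N)) (j : ℕ) (v : Fin N' → E N → ℝ) : ℝ :=
  √(∑ i, ∑ α ∈ multiIndices N j, ∫ x in Υ, (weakDeriv Υ α (v i) x) ^ 2)

/-- The classical action on `ℝ^{N'}`-valued fields of the homogeneous linear differential operator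
of degree `d`, with values in `ℝ^{N''}` and constant coefficients `a α i' i''`. -/
noncomputable def diffOp {N N' N'' : ℕ} (d : ℕ) (a : MultiIndex N → Fin N' → Fin N'' → ℝ)
    (v : Fin N' → E N → ℝ) (i'' : Fin N'') (x : E N) : ℝ :=
  ∑ i', ∑ α ∈ multiIndices N d, a α i' i'' * classicalDeriv α (v i') x

/-- `u` solves `𝓛 u = 0` on `Υ` in the sense of distributions. -/
def IsDistribSolution {N N' N'' : ℕ} (Υ : Set (E N)) (d : ℕ)
    (a : MultiIndex N → Fin N' → Fin N'' → ℝ) (u : Fin N' → E N → ℝ) : Prop :=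
  ∀ i'' : Fin N'', ∀ η : E N → ℝ, IsTestFunction Υ η →
    ∑ i', ∑ α ∈ multiIndices N d,
      a α i' i'' * ((-1) ^ d * ∫ x in Υ, u i' x * classicalDeriv α η x) = 0

/-- `∑_{|α| < m} (1/α!) D^α v(z) (x - z)^α`, where `Dv α` is the derivative `D^α v`. -/
noncomputable def taylorSum {N : ℕ} (m : ℕ) (Dv : MultiIndex N → E N → ℝ) (z x : E N) : ℝ :=
  ∑ k ∈ Finset.range m, ∑ α ∈ multiIndices N k,
    1 / (MultiIndex.fact α : ℝ) * Dv α z * monomial α (x - z)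

/-- The Taylor polynomial `T^m_z[v]` of order `m`, with classical derivatives at `z`. -/
noncomputable def taylorPoly {N N' : ℕ} (m : ℕ) (v : Fin N' → E N → ℝ) (z : E N) :
    Fin N' → E N → ℝ :=
  fun i x => taylorSum m (fun α => classicalDeriv α (v i)) z x

/-- The averaged Taylor polynomial `Q^m[v](x) = |B|⁻¹ ∫_B T^m_z[v](x) dz`, with weak derivatives
of `v` on `Υ`. -/
noncomputable def averagedTaylor {N N' : ℕ} (Υ B : Set (E N)) (m : ℕ)
    (v : Fin N' → E N → ℝ) : Fin N' → E N → ℝ :=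
  fun i x => (volume.real B)⁻¹ * ∫ z in B, taylorSum m (fun α => weakDeriv Υ α (v i)) z x

/-- `f : ℝ^N → ℝ` is a polynomial function of total degree at most `k`. -/
def IsPolyOfDegreeLE {N : ℕ} (k : ℕ) (f : E N → ℝ) : Prop :=
  ∃ p : MvPolynomial (Fin N) ℝ, p.totalDegree ≤ k ∧
    ∀ x : E N, f x = MvPolynomial.eval (fun i => x i) p

/-- `A` is star-shaped with respect to its subset `B`. -/
def StarShapedWrt {N : ℕ} (A B : Set (E N)) : Prop :=
  B ⊆ A ∧ ∀ x ∈ A, ∀ b ∈ B, segment ℝ x b ⊆ A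

end AveragedTaylor

open scoped ENNReal

namespace AveragedTaylor

variable {N : ℕ}

/-! Algebraic half. Differentiating a Taylor sum only shifts its coefficients: `D^α` turns the sum
of order `m` with coefficients `G β` into the sum of order `m - |α|` with coefficients `G (β + α)`
(`classicalDeriv_taylorSum`). Applying `𝓛` to a Taylor polynomial at `z` therefore produces
combinations of the numbers `(𝓛 D^β u)(z)` with `|β| + d < m`. These vanish for almost every `z`,
because `𝓛` has constant coefficients and can be tested against `D^β η`
(`IsDistribSolution.ae_sum_eq_zero`); continuity gives every `z` in the classical case, integration
over `B` gives the averaged case. Recentring all the polynomials at one fixed point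
(`taylorSum_recenter`) shows that the average is again a Taylor sum, so its degree and derivatives
need no differentiation under the integral.

Analytic half. The same shift gives `D^α Q^m u = Q^{m-j} (D^α u)` for `|α| = j`, so only the `L²`
error of `Q^n`, `n = m - j`, is needed. Taylor's formula holds for mollifications along segments
inside `Υ`. An `L¹` limit (`IsWeakJet.ae_enorm_sub_taylorSum_le`) bounds `|u(x) - T_z u(x)|`, for
almost every pair `(x, z)`, by the sum over `|β| = n` of `n/β! * h^n` times the integral of `|D^β
u|` over `t ∈ (0, 1)` at `z + t(x - z)`. Averaging over `z ∈ B` and using Cauchy–Schwarz reduces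
everything to `lintegral_segment_le`: after division by `|B|`, the integral of `f(z + t(x - z))`
over `Υ × B` is at most `ρ^{-N} ∫ f`, uniformly in `t`. This is the source of `ρ^{-N/2}`. The
multinomial theorem gives `∑ n/β! = N^n/(n-1)!`, and counting multi-indices gives the binomial
coefficient. -/

/-! ### Multi-indices and monomials -/

@[simp] lemma MultiIndex.length_add (α β : MultiIndex N) :
    MultiIndex.length (α + β) = MultiIndex.length α + MultiIndex.length β := by
  simp [MultiIndex.length, Finset.sum_add_distrib]

@[simp] lemma MultiIndex.length_single (i : Fin N) :
    MultiIndex.length (Pi.single i 1 : MultiIndex N) = 1 := by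
  simp [MultiIndex.length, Pi.single_apply]

@[simp] lemma MultiIndex.length_zero : MultiIndex.length (0 : MultiIndex N) = 0 := by
  simp [MultiIndex.length]

lemma MultiIndex.length_eq_zero {α : MultiIndex N} : MultiIndex.length α = 0 ↔ α = 0 := by
  simp [MultiIndex.length, funext_iff]

lemma multiIndices_zero : multiIndices N 0 = {0} := by
  ext α
  simp [mem_multiIndices, MultiIndex.length_eq_zero]

lemma MultiIndex.sub_single_add {β : MultiIndex N} {i : Fin N} (h : β i ≠ 0) :
    β - Pi.single i 1 + Pi.single i 1 = β := by
  funext j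
  rcases eq_or_ne j i with rfl | hj
  · simp; omega
  · simp [hj]

lemma MultiIndex.fact_pos (α : MultiIndex N) : 0 < MultiIndex.fact α :=
  Finset.prod_pos fun _ _ => Nat.factorial_pos _

lemma MultiIndex.fact_add_single (α : MultiIndex N) (i : Fin N) :
    MultiIndex.fact (α + Pi.single i 1) = (α i + 1) * MultiIndex.fact α := by
  unfold MultiIndex.fact
  rw [← Finset.mul_prod_erase _ _ (Finset.mem_univ i),
    ← Finset.mul_prod_erase _ (fun j => (α j)!) (Finset.mem_univ i), ← mul_assoc]
  congr 1
  · simp [Nat.factorial_succ]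
  · refine Finset.prod_congr rfl fun j hj => ?_
    simp [Finset.ne_of_mem_erase hj]

lemma monomial_add_single (α : MultiIndex N) (i : Fin N) (x : E N) :
    monomial (α + Pi.single i 1) x = x i * monomial α x := by
  unfold monomial
  rw [← Finset.mul_prod_erase _ _ (Finset.mem_univ i),
    ← Finset.mul_prod_erase _ (fun j => x j ^ α j) (Finset.mem_univ i), ← mul_assoc]
  congr 1
  · simp [pow_succ, mul_comm]
  · refine Finset.prod_congr rfl fun j hj => ?_
    simp [Finset.ne_of_mem_erase hj]

/-- Reindexing a sum over multi-indices of length `k + 1` by `β = α + e_i`. -/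
lemma sum_multiIndices_succ {M : Type*} [AddCommMonoid M] (k : ℕ) (i : Fin N)
    (f : MultiIndex N → M) (hf : ∀ β, β i = 0 → f β = 0) :
    ∑ β ∈ multiIndices N (k + 1), f β = ∑ α ∈ multiIndices N k, f (α + Pi.single i 1) := by
  symm
  refine Finset.sum_of_injOn (fun α => α + Pi.single i 1) ?_ ?_ ?_ ?_
  · exact fun a _ b _ hab => add_right_cancel hab
  · intro α hα
    simp only [Finset.mem_coe, mem_multiIndices] at hα ⊢
    simp [hα]
  · intro β hβ hn
    refine hf β ?_
    by_contra h0
    refine hn ⟨β - Pi.single i 1, ?_, MultiIndex.sub_single_add h0⟩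
    have h1 := congrArg MultiIndex.length (MultiIndex.sub_single_add h0)
    simp only [mem_multiIndices] at hβ
    simp only [MultiIndex.length_add, MultiIndex.length_single] at h1
    simp only [Finset.mem_coe, mem_multiIndices]
    omega
  · intros; rfl

/-- The contraction identity behind the multivariate Taylor formula. -/
lemma sum_sum_mul_shift (k : ℕ) (v : E N) (g : MultiIndex N → ℝ) :
    ∑ α ∈ multiIndices N k, 1 / (MultiIndex.fact α : ℝ) * monomial α v *
        ∑ i, v i * g (α + Pi.single i 1)
      = (k + 1) * ∑ β ∈ multiIndices N (k + 1),
          1 / (MultiIndex.fact β : ℝ) * g β * monomial β v := by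
  -- For fixed `i`, the substitution `β = α + e_i` turns `1/α!` into `β_i/β!`; summing over `i` then
  -- gives `∑ β_i = k + 1`.
  have key : ∀ i : Fin N, ∑ α ∈ multiIndices N k,
      1 / (MultiIndex.fact α : ℝ) * monomial α v * (v i * g (α + Pi.single i 1))
      = ∑ β ∈ multiIndices N (k + 1),
        (β i : ℝ) * (1 / (MultiIndex.fact β : ℝ) * g β * monomial β v) := by
    intro i
    rw [sum_multiIndices_succ k i _ (fun β hβ => by simp [hβ])]
    refine Finset.sum_congr rfl fun α _ => ?_
    rw [MultiIndex.fact_add_single, monomial_add_single]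
    have : (MultiIndex.fact α : ℝ) ≠ 0 := by exact_mod_cast (MultiIndex.fact_pos α).ne'
    have h2 : ((α i : ℝ) + 1) ≠ 0 := by positivity
    simp only [Pi.add_apply, Pi.single_eq_same]
    push_cast
    field_simp
  simp_rw [Finset.mul_sum]
  rw [Finset.sum_comm]
  simp_rw [key]
  rw [Finset.sum_comm]
  refine Finset.sum_congr rfl fun β hβ => ?_
  rw [← Finset.sum_mul]
  congr 1
  rw [mem_multiIndices] at hβ
  rw [← Nat.cast_sum]
  exact_mod_cast hβ

/-! ### Taylor sums and their derivatives -/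

lemma contDiff_monomial (α : MultiIndex N) : ContDiff ℝ ∞ (monomial α) := by
  unfold monomial
  fun_prop

lemma contDiff_taylorSum (m : ℕ) (G : MultiIndex N → E N → ℝ) (z : E N) :
    ContDiff ℝ ∞ (taylorSum m G z) := by
  unfold taylorSum
  refine ContDiff.sum fun k _ => ContDiff.sum fun α _ => contDiff_const.mul ?_
  exact (contDiff_monomial α).comp (contDiff_id.sub contDiff_const)

lemma partialDeriv_eq_fderiv {f : E N → ℝ} {x : E N} (hf : DifferentiableAt ℝ f x) (i : Fin N) :
    partialDeriv i f x = fderiv ℝ f x (EuclideanSpace.single i 1) :=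
  hf.lineDeriv_eq_fderiv

lemma fderiv_eq_sum_partialDeriv {f : E N → ℝ} {x : E N} (hf : DifferentiableAt ℝ f x) (v : E N) :
    fderiv ℝ f x v = ∑ i, v i * partialDeriv i f x := by
  have hv : v = ∑ i, v i • EuclideanSpace.single i (1 : ℝ) := by
    ext j
    simp [Finset.sum_apply, Pi.single_apply]
  conv_lhs => rw [hv]
  simp [map_sum, partialDeriv_eq_fderiv hf]

lemma hasLineDerivAt_monomial_sub (α : MultiIndex N) (i : Fin N) (z x : E N) :
    HasLineDerivAt ℝ (fun x => monomial α (x - z)) (α i * monomial (α - Pi.single i 1) (x - z)) x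
      (EuclideanSpace.single i 1) := by
  have h1 : ∀ t : ℝ, monomial α (x + t • EuclideanSpace.single i (1 : ℝ) - z)
      = (x i - z i + t) ^ α i * ∏ j ∈ Finset.univ.erase i, (x j - z j) ^ α j := by
    intro t
    unfold monomial
    rw [← Finset.mul_prod_erase _ _ (Finset.mem_univ i)]
    congr 1
    · simp; ring
    · refine Finset.prod_congr rfl fun j hj => ?_
      simp [Finset.ne_of_mem_erase hj]
  unfold HasLineDerivAt
  simp_rw [h1]
  have h2 : HasDerivAt (fun t : ℝ => (x i - z i + t) ^ α i) (α i * (x i - z i + 0) ^ (α i - 1)) 0 := by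
    simpa using ((hasDerivAt_id (0 : ℝ)).const_add (x i - z i)).fun_pow (α i)
  have h3 : monomial (α - Pi.single i 1) (x - z)
      = (x i - z i) ^ (α i - 1) * ∏ j ∈ Finset.univ.erase i, (x j - z j) ^ α j := by
    unfold monomial
    rw [← Finset.mul_prod_erase _ _ (Finset.mem_univ i)]
    congr 1
    · simp
    · refine Finset.prod_congr rfl fun j hj => ?_
      simp [Finset.ne_of_mem_erase hj]
  refine (h2.mul_const _).congr_deriv ?_
  rw [h3, add_zero, mul_assoc]

/-- The factor `α_i` produced by the monomial cancels against `α!`, so no combinatorial constant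
survives the shift. The coefficients at `z` are arbitrary numbers, which lets the same lemma serve
classical and weak derivatives. -/
lemma partialDeriv_taylorSum (m : ℕ) (G : MultiIndex N → E N → ℝ) (z : E N) (i : Fin N) :
    partialDeriv i (taylorSum m G z) = taylorSum (m - 1) (fun α => G (α + Pi.single i 1)) z := by
  funext x
  have h : HasLineDerivAt ℝ (taylorSum m G z) (∑ k ∈ Finset.range m, ∑ α ∈ multiIndices N k,
      1 / (MultiIndex.fact α : ℝ) * G α z * (α i * monomial (α - Pi.single i 1) (x - z))) x
      (EuclideanSpace.single i 1) := by
    unfold HasLineDerivAt taylorSum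
    refine HasDerivAt.fun_sum fun k _ => HasDerivAt.fun_sum fun α _ => ?_
    exact (hasLineDerivAt_monomial_sub α i z x).const_mul _
  unfold partialDeriv
  rw [h.lineDeriv]
  cases m with
  | zero => simp [taylorSum]
  | succ m =>
    rw [Finset.sum_range_succ', multiIndices_zero]
    simp only [Finset.sum_singleton, Pi.zero_apply, Nat.cast_zero, zero_mul, mul_zero, add_zero,
      Nat.add_sub_cancel, taylorSum]
    refine Finset.sum_congr rfl fun k _ => ?_
    rw [sum_multiIndices_succ k i _ (fun β hβ => by simp [hβ])]
    refine Finset.sum_congr rfl fun α _ => ?_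
    rw [MultiIndex.fact_add_single, add_tsub_cancel_right]
    have : (MultiIndex.fact α : ℝ) ≠ 0 := by exact_mod_cast (MultiIndex.fact_pos α).ne'
    have h2 : ((α i : ℝ) + 1) ≠ 0 := by positivity
    simp only [Pi.add_apply, Pi.single_eq_same]
    push_cast
    field_simp

/-- Iterated partial derivatives along a list of directions. -/
noncomputable def listDeriv (l : List (Fin N)) (f : E N → ℝ) : E N → ℝ :=
  l.foldr partialDeriv f

/-- The multi-index counting the occurrences in a list of directions. -/
def listIndex (l : List (Fin N)) : MultiIndex N := fun i => l.count i

@[simp] lemma listDeriv_nil (f : E N → ℝ) : listDeriv [] f = f := rfl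

@[simp] lemma listDeriv_cons (i : Fin N) (l : List (Fin N)) (f : E N → ℝ) :
    listDeriv (i :: l) f = partialDeriv i (listDeriv l f) := rfl

lemma listDeriv_append (l l' : List (Fin N)) (f : E N → ℝ) :
    listDeriv (l ++ l') f = listDeriv l (listDeriv l' f) := by
  simp [listDeriv]

@[simp] lemma listIndex_nil : listIndex ([] : List (Fin N)) = 0 := by
  funext i; simp [listIndex]

@[simp] lemma listIndex_cons (i : Fin N) (l : List (Fin N)) :
    listIndex (i :: l) = listIndex l + Pi.single i 1 := by
  funext j
  rcases eq_or_ne j i with rfl | hj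
  · simp [listIndex]
  · simp [listIndex, hj, hj.symm]

lemma length_listIndex (l : List (Fin N)) : MultiIndex.length (listIndex l) = l.length := by
  induction l with
  | nil => simp
  | cons i l ih => simp [ih]

lemma perm_of_listIndex_eq {l l' : List (Fin N)} (h : listIndex l = listIndex l') : l.Perm l' :=
  List.perm_iff_count.2 fun i => congrFun h i

/-- The list of directions `0, …, 0, 1, …, 1, …` in which `i` occurs `α i` times. -/
def MultiIndex.toList (α : MultiIndex N) : List (Fin N) :=
  (List.finRange N).flatMap fun i => List.replicate (α i) i

lemma listIndex_toList (α : MultiIndex N) : listIndex α.toList = α := by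
  funext i
  unfold listIndex MultiIndex.toList
  rw [List.count_flatMap]
  simp only [Function.comp_def, List.count_replicate, beq_iff_eq]
  rw [← Fin.sum_univ_def]
  simp

/-- Lists of directions make induction on the order of differentiation possible and turn the
symmetry of mixed derivatives into a statement about permutations. -/
lemma classicalDeriv_eq_listDeriv (α : MultiIndex N) (f : E N → ℝ) :
    classicalDeriv α f = listDeriv α.toList f := by
  unfold classicalDeriv MultiIndex.toList
  have hrep : ∀ (n : ℕ) (i : Fin N) (g : E N → ℝ),
      (partialDeriv i)^[n] g = listDeriv (List.replicate n i) g := by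
    intro n i g
    induction n with
    | zero => rfl
    | succ n ih => rw [Function.iterate_succ_apply', ih]; rfl
  induction List.finRange N with
  | nil => rfl
  | cons i l ih =>
    rw [List.foldr_cons, ih, List.flatMap_cons, listDeriv_append, hrep]

lemma listDeriv_taylorSum (l : List (Fin N)) (m : ℕ) (G : MultiIndex N → E N → ℝ) (z : E N) :
    listDeriv l (taylorSum m G z) = taylorSum (m - l.length) (fun α => G (α + listIndex l)) z := by
  induction l with
  | nil => simp
  | cons i l ih =>
    rw [listDeriv_cons, ih, partialDeriv_taylorSum, List.length_cons, listIndex_cons,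
      Nat.sub_sub]
    congr 1
    funext α
    rw [add_assoc, add_comm (Pi.single i 1)]

lemma classicalDeriv_taylorSum (α : MultiIndex N) (m : ℕ) (G : MultiIndex N → E N → ℝ)
    (z : E N) :
    classicalDeriv α (taylorSum m G z)
      = taylorSum (m - MultiIndex.length α) (fun β => G (β + α)) z := by
  rw [classicalDeriv_eq_listDeriv, listDeriv_taylorSum, ← length_listIndex, listIndex_toList]

/-! ### Taylor's formula and recentring -/

/-- **Taylor's formula** for a family `F` of functions playing the role of the derivatives of `F 0`
along a segment. -/
theorem taylor_formula (n : ℕ) (F : MultiIndex N → E N → ℝ) (z v : E N)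
    (hF : ∀ α, MultiIndex.length α < n → ∀ t ∈ Set.Icc (0 : ℝ) 1,
      HasDerivAt (fun s : ℝ => F α (z + s • v)) (∑ i, v i * F (α + Pi.single i 1) (z + t • v)) t)
    (hc : ∀ α, MultiIndex.length α = n →
      ContinuousOn (fun t : ℝ => F α (z + t • v)) (Set.Icc 0 1)) (hn : 1 ≤ n) :
    F 0 (z + v) - taylorSum n F z (z + v) = ∫ t in (0 : ℝ)..1, n * (1 - t) ^ (n - 1) *
      ∑ β ∈ multiIndices N n, 1 / (MultiIndex.fact β : ℝ) * F β (z + t • v) * monomial β v := by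
  -- `Φ n` interpolates between the Taylor sum at `t = 0` and `F 0 (z + v)` at `t = 1`, where only
  -- the term `k = 0` survives. Its derivative telescopes, leaving the terms of order `n` alone.
  set Φ : ℕ → ℝ → ℝ := fun n t => ∑ k ∈ Finset.range n, (1 - t) ^ k * ∑ α ∈ multiIndices N k,
    1 / (MultiIndex.fact α : ℝ) * monomial α v * F α (z + t • v) with hΦ
  have hderiv : ∀ p ≤ n, ∀ t ∈ Set.Icc (0 : ℝ) 1, HasDerivAt (Φ p) (p * (1 - t) ^ (p - 1) *
      ∑ β ∈ multiIndices N p, 1 / (MultiIndex.fact β : ℝ) * F β (z + t • v) * monomial β v) t := by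
    intro p
    induction p with
    | zero => intro _ t _; simpa [hΦ] using hasDerivAt_const t (0 : ℝ)
    | succ p ih =>
      intro hp t ht
      have h1 := ih (by omega) t ht
      have h2 : HasDerivAt (fun s : ℝ => ∑ α ∈ multiIndices N p,
          1 / (MultiIndex.fact α : ℝ) * monomial α v * F α (z + s • v))
          (∑ α ∈ multiIndices N p, 1 / (MultiIndex.fact α : ℝ) * monomial α v *
            ∑ i, v i * F (α + Pi.single i 1) (z + t • v)) t := by
        refine HasDerivAt.fun_sum fun α hα => (hF α ?_ t ht).const_mul _
        rw [mem_multiIndices] at hα; omega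
      have h3 : HasDerivAt (fun s : ℝ => (1 - s) ^ p) (-(p * (1 - t) ^ (p - 1))) t := by
        simpa using ((hasDerivAt_id t).const_sub 1).fun_pow p
      have h4 := h1.add (h3.mul h2)
      rw [sum_sum_mul_shift p v (fun β => F β (z + t • v))] at h4
      have h5 : Φ (p + 1) = Φ p + fun s => (1 - s) ^ p * ∑ α ∈ multiIndices N p,
          1 / (MultiIndex.fact α : ℝ) * monomial α v * F α (z + s • v) := by
        funext s
        simp [hΦ, Finset.sum_range_succ]
      rw [h5]
      refine h4.congr_deriv ?_
      have h6 : ∑ α ∈ multiIndices N p, 1 / (MultiIndex.fact α : ℝ) * monomial α v *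
          F α (z + t • v) = ∑ α ∈ multiIndices N p, 1 / (MultiIndex.fact α : ℝ) *
            F α (z + t • v) * monomial α v :=
        Finset.sum_congr rfl fun α _ => by ring
      rw [h6]
      push_cast
      ring
  have h1 : Φ n 1 = F 0 (z + v) := by
    obtain ⟨p, rfl⟩ : ∃ p, n = p + 1 := ⟨n - 1, by omega⟩
    simp [hΦ, Finset.sum_range_succ', multiIndices_zero, MultiIndex.fact, monomial]
  have h0 : Φ n 0 = taylorSum n F z (z + v) := by
    simp only [hΦ, taylorSum]
    refine Finset.sum_congr rfl fun k _ => ?_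
    simp only [sub_zero, one_pow, one_mul, zero_smul, add_zero, add_sub_cancel_left]
    exact Finset.sum_congr rfl fun α _ => by ring
  rw [← h1, ← h0]
  symm
  refine intervalIntegral.integral_eq_sub_of_hasDerivAt (fun t ht => hderiv n le_rfl t ?_) ?_
  · rwa [Set.uIcc_of_le zero_le_one] at ht
  · refine ContinuousOn.intervalIntegrable ?_
    rw [Set.uIcc_of_le zero_le_one]
    refine ContinuousOn.mul (by fun_prop) (continuousOn_finsetSum _ fun β hβ => ?_)
    exact (continuousOn_const.mul (hc β (mem_multiIndices.1 hβ))).mul continuousOn_const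

/-- A Taylor polynomial centred at `z`, recentred at `y`. -/
lemma taylorSum_recenter (m : ℕ) (G : MultiIndex N → E N → ℝ) (y z x : E N) :
    taylorSum m G z x = taylorSum m (fun α y => taylorSum (m - MultiIndex.length α)
      (fun β => G (β + α)) z y) y x := by
  rcases Nat.eq_zero_or_pos m with rfl | hm
  · simp [taylorSum]
  set F : MultiIndex N → E N → ℝ := fun α y => taylorSum (m - MultiIndex.length α)
      (fun β => G (β + α)) z y with hFdef
  have hd : ∀ α, ContDiff ℝ ∞ (F α) := fun α => contDiff_taylorSum _ _ _
  have hp : ∀ α i, partialDeriv i (F α) = F (α + Pi.single i 1) := by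
    intro α i
    simp only [hFdef]
    rw [partialDeriv_taylorSum]
    simp only [MultiIndex.length_add, MultiIndex.length_single, Nat.sub_sub]
    funext y
    congr 1
    funext β
    rw [add_assoc, add_comm (Pi.single i 1)]
  have h := taylor_formula m F y (x - y) (fun α _ t _ => ?_) (fun α _ => ?_) hm
  -- The remainder vanishes: at `|β| = m` the sum has order `m - m = 0` and is empty.
  · have h0 : ∀ t : ℝ, ∑ β ∈ multiIndices N m, 1 / (MultiIndex.fact β : ℝ) *
        F β (y + t • (x - y)) * monomial β (x - y) = 0 := by
      intro t
      refine Finset.sum_eq_zero fun β hβ => ?_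
      rw [mem_multiIndices] at hβ
      simp [hFdef, hβ, taylorSum]
    simp only [h0, mul_zero, intervalIntegral.integral_zero, add_sub_cancel, sub_eq_zero] at h
    rw [← h]
    simp [hFdef]
  · have hdiff : DifferentiableAt ℝ (F α) (y + t • (x - y)) :=
      ((hd α).differentiable (by simp)).differentiableAt
    have h1 : HasDerivAt (fun s : ℝ => y + s • (x - y)) (x - y) t := by
      simpa using ((hasDerivAt_id t).smul_const (x - y)).const_add y
    have h2 := hdiff.hasFDerivAt.comp_hasDerivAt t h1
    rw [fderiv_eq_sum_partialDeriv hdiff] at h2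
    simp only [hp] at h2
    exact h2
  · have := (hd α).continuous
    fun_prop

lemma isPolyOfDegreeLE_taylorSum (m : ℕ) (H : MultiIndex N → E N → ℝ) (y : E N) :
    IsPolyOfDegreeLE (m - 1) (taylorSum m H y) := by
  refine ⟨∑ k ∈ Finset.range m, ∑ α ∈ multiIndices N k,
    MvPolynomial.C (1 / (MultiIndex.fact α : ℝ) * H α y) *
      ∏ i, (MvPolynomial.X i - MvPolynomial.C (y i)) ^ α i, ?_, fun x => ?_⟩
  · refine MvPolynomial.totalDegree_finsetSum_le fun k hk =>
      MvPolynomial.totalDegree_finsetSum_le fun α hα => ?_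
    refine (MvPolynomial.totalDegree_mul _ _).trans ?_
    rw [MvPolynomial.totalDegree_C, zero_add]
    refine (MvPolynomial.totalDegree_finsetProd _ _).trans ?_
    have : ∑ i, α i ≤ m - 1 := by
      rw [mem_multiIndices, MultiIndex.length] at hα
      have := Finset.mem_range.1 hk
      omega
    refine (Finset.sum_le_sum fun i _ => ?_).trans this
    refine (MvPolynomial.totalDegree_pow _ _).trans ?_
    have h1 : (MvPolynomial.X i - MvPolynomial.C (y i) : MvPolynomial (Fin N) ℝ).totalDegree ≤ 1 :=
      (MvPolynomial.totalDegree_sub _ _).trans (by simp)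
    nlinarith
  · simp [taylorSum, monomial]

/-! ### Classical derivatives and symmetry of mixed partials -/

section Classical

variable {U : Set (E N)}

lemma partialDeriv_congr (hU : IsOpen U) {f g : E N → ℝ} (h : Set.EqOn f g U) (i : Fin N) :
    Set.EqOn (partialDeriv i f) (partialDeriv i g) U := fun _ hx =>
  (h.eventuallyEq_of_mem (hU.mem_nhds hx)).lineDeriv_eq

lemma eqOn_partialDeriv_fderiv (hU : IsOpen U) {f : E N → ℝ} (hf : ContDiffOn ℝ 1 f U)
    (i : Fin N) :
    Set.EqOn (partialDeriv i f) (fun x => fderiv ℝ f x (EuclideanSpace.single i 1)) U :=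
  fun _ hx => partialDeriv_eq_fderiv
    ((hf.differentiableOn (by simp)).differentiableAt (hU.mem_nhds hx)) i

lemma contDiffOn_partialDeriv (hU : IsOpen U) {f : E N → ℝ} {k : ℕ}
    (hf : ContDiffOn ℝ (k + 1 : ℕ) f U) (i : Fin N) : ContDiffOn ℝ k (partialDeriv i f) U := by
  refine ContDiffOn.congr ?_ (eqOn_partialDeriv_fderiv hU (hf.of_le (by simp)) i)
  exact (hf.fderiv_of_isOpen hU (by simp)).clm_apply contDiffOn_const

lemma contDiffOn_listDeriv (hU : IsOpen U) {f : E N → ℝ} {k : ℕ} (l : List (Fin N))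
    (hf : ContDiffOn ℝ (k + l.length : ℕ) f U) : ContDiffOn ℝ k (listDeriv l f) U := by
  induction l generalizing k with
  | nil => simpa using hf
  | cons i l ih =>
    refine contDiffOn_partialDeriv hU (ih ?_) i
    rw [List.length_cons] at hf
    rwa [show k + 1 + l.length = k + (l.length + 1) by ring]

lemma partialDeriv_comm (hU : IsOpen U) {f : E N → ℝ} (hf : ContDiffOn ℝ (2 : ℕ) f U)
    (i j : Fin N) :
    Set.EqOn (partialDeriv i (partialDeriv j f)) (partialDeriv j (partialDeriv i f)) U := by
  have h2 : ∀ i j : Fin N, Set.EqOn (partialDeriv i (partialDeriv j f)) (fun x =>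
      fderiv ℝ (fderiv ℝ f) x (EuclideanSpace.single i 1) (EuclideanSpace.single j 1)) U := by
    intro i j x hx
    have h1 : ContDiffOn ℝ 1 f U := hf.of_le (by norm_num)
    rw [partialDeriv_congr hU (eqOn_partialDeriv_fderiv hU h1 j) i hx]
    have hd : DifferentiableAt ℝ (fderiv ℝ f) x :=
      ((hf.fderiv_of_isOpen (m := 1) hU (by norm_num)).differentiableOn (by simp)).differentiableAt
        (hU.mem_nhds hx)
    rw [partialDeriv_eq_fderiv (hd.clm_apply (differentiableAt_const _)),
      fderiv_clm_apply hd (differentiableAt_const _)]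
    simp
  intro x hx
  rw [h2 i j hx, h2 j i hx]
  exact ((hf.contDiffAt (hU.mem_nhds hx)).isSymmSndFDerivAt (by simp)).eq _ _

/-- Permutations are generated by adjacent swaps, and each swap is Schwarz's theorem for a function
of class `C²`. -/
lemma listDeriv_perm (hU : IsOpen U) {f : E N → ℝ} {l l' : List (Fin N)} (h : l.Perm l')
    (hf : ContDiffOn ℝ (l.length : ℕ) f U) : Set.EqOn (listDeriv l f) (listDeriv l' f) U := by
  induction h with
  | nil => exact fun _ _ => rfl
  | cons i _ ih =>
    exact partialDeriv_congr hU (ih (hf.of_le (by simp))) i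
  | swap i j l =>
    simp only [listDeriv_cons]
    refine partialDeriv_comm hU (contDiffOn_listDeriv hU l (hf.of_le ?_)) j i
    exact_mod_cast (show 2 + l.length ≤ (j :: i :: l).length by simp; omega)
  | trans h1 _ ih1 ih2 => exact (ih1 hf).trans (ih2 (by rwa [← h1.length_eq]))

lemma listDeriv_eqOn_classicalDeriv (hU : IsOpen U) {f : E N → ℝ} {α : MultiIndex N}
    {l : List (Fin N)} (hl : listIndex l = α)
    (hf : ContDiffOn ℝ (MultiIndex.length α : ℕ) f U) :
    Set.EqOn (listDeriv l f) (classicalDeriv α f) U := by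
  rw [classicalDeriv_eq_listDeriv]
  refine listDeriv_perm hU (perm_of_listIndex_eq ?_) ?_
  · rw [hl, listIndex_toList]
  · rwa [← length_listIndex, hl]

lemma MultiIndex.length_toList (α : MultiIndex N) : α.toList.length = MultiIndex.length α := by
  rw [← length_listIndex, listIndex_toList]

lemma listIndex_append (l l' : List (Fin N)) :
    listIndex (l ++ l') = listIndex l + listIndex l' := by
  funext i
  simp [listIndex]

lemma contDiffOn_classicalDeriv (hU : IsOpen U) {f : E N → ℝ} {k : ℕ} (α : MultiIndex N)
    (hf : ContDiffOn ℝ (k + MultiIndex.length α : ℕ) f U) :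
    ContDiffOn ℝ k (classicalDeriv α f) U := by
  rw [classicalDeriv_eq_listDeriv]
  exact contDiffOn_listDeriv hU _ (by rwa [MultiIndex.length_toList])

lemma classicalDeriv_classicalDeriv {f : E N → ℝ} (hf : ContDiff ℝ ∞ f) (α β : MultiIndex N) :
    classicalDeriv α (classicalDeriv β f) = classicalDeriv (α + β) f := by
  rw [classicalDeriv_eq_listDeriv α, classicalDeriv_eq_listDeriv β, ← listDeriv_append]
  funext x
  refine listDeriv_eqOn_classicalDeriv isOpen_univ ?_ ?_ (Set.mem_univ x)
  · simp [listIndex_append, listIndex_toList]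
  · exact (hf.of_le (by exact_mod_cast le_top)).contDiffOn

lemma classicalDeriv_single (i : Fin N) (f : E N → ℝ) :
    classicalDeriv (Pi.single i 1) f = partialDeriv i f := by
  rw [classicalDeriv_eq_listDeriv]
  have h : (MultiIndex.toList (Pi.single i 1 : MultiIndex N)).Perm [i] :=
    perm_of_listIndex_eq (by simp [listIndex_toList])
  rw [List.perm_singleton.1 h]
  rfl

end Classical

/-! ### Test functions and integration by parts -/

section Test

variable {Υ : Set (E N)} {η : E N → ℝ}

lemma IsTestFunction.partialDeriv (hη : IsTestFunction Υ η) (i : Fin N) :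
    IsTestFunction Υ (partialDeriv i η) := by
  have h : AveragedTaylor.partialDeriv i η
      = fun x => fderiv ℝ η x (EuclideanSpace.single i 1) := by
    funext x
    exact partialDeriv_eq_fderiv (hη.1.differentiable (by simp)).differentiableAt i
  rw [h]
  refine ⟨?_, hη.2.1.fderiv_apply ℝ _, (tsupport_fderiv_apply_subset ℝ _).trans hη.2.2⟩
  exact (hη.1.fderiv_right (by simp)).clm_apply contDiff_const

lemma IsTestFunction.listDeriv (hη : IsTestFunction Υ η) (l : List (Fin N)) :
    IsTestFunction Υ (listDeriv l η) := by
  induction l with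
  | nil => exact hη
  | cons i l ih => exact ih.partialDeriv i

lemma IsTestFunction.classicalDeriv (hη : IsTestFunction Υ η) (α : MultiIndex N) :
    IsTestFunction Υ (classicalDeriv α η) := by
  rw [classicalDeriv_eq_listDeriv]
  exact hη.listDeriv _

lemma IsTestFunction.eq_zero (hη : IsTestFunction Υ η) {x : E N} (hx : x ∉ Υ) : η x = 0 :=
  image_eq_zero_of_notMem_tsupport fun h => hx (hη.2.2 h)

lemma IsTestFunction.setIntegral (hη : IsTestFunction Υ η) (g : E N → ℝ) :
    ∫ x in Υ, g x * η x = ∫ x, g x * η x :=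
  setIntegral_eq_integral_of_forall_compl_eq_zero fun x hx => by simp [hη.eq_zero hx]

lemma IsTestFunction.integrable_mul (hη : IsTestFunction Υ η) {g : E N → ℝ}
    (hg : LocallyIntegrableOn g Υ) : Integrable (fun x => g x * η x) := by
  have h1 : IntegrableOn g (tsupport η) := hg.integrableOn_compact_subset hη.2.2 hη.2.1
  have h2 := h1.mul_continuousOn hη.1.continuous.continuousOn hη.2.1
  refine (integrableOn_iff_integrable_of_support_subset fun x hx => ?_).1 h2
  by_contra h
  exact hx (by simp [image_eq_zero_of_notMem_tsupport h])

lemma integral_mul_partialDeriv (hΥ : IsOpen Υ) {f : E N → ℝ} (hf : ContDiffOn ℝ (1 : ℕ) f Υ)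
    (hη : IsTestFunction Υ η) (i : Fin N) :
    ∫ x in Υ, f x * partialDeriv i η x = -∫ x in Υ, partialDeriv i f x * η x := by
  rw [hη.setIntegral, (hη.partialDeriv i).setIntegral]
  have h0 : LocallyIntegrableOn f Υ := hf.continuousOn.locallyIntegrableOn hΥ.measurableSet
  have h1 : LocallyIntegrableOn (partialDeriv i f) Υ :=
    (contDiffOn_partialDeriv (k := 0) hΥ (by simpa using hf) i).continuousOn.locallyIntegrableOn
      hΥ.measurableSet
  refine integral_bilinear_hasLineDerivAt_right_eq_neg_left_of_integrable
    (B := ContinuousLinearMap.mul ℝ ℝ) (v := EuclideanSpace.single i 1)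
    (hη.integrable_mul h1) ((hη.partialDeriv i).integrable_mul h0) (hη.integrable_mul h0)
    (fun x hx => ?_) (fun x _ => ?_)
  · exact (((hf.differentiableOn (by simp)).differentiableAt
      (hΥ.mem_nhds (hη.2.2 hx))).lineDifferentiableAt).hasLineDerivAt
  · exact ((hη.1.differentiable (by simp)).differentiableAt.lineDifferentiableAt).hasLineDerivAt

lemma integral_mul_listDeriv (hΥ : IsOpen Υ) (l : List (Fin N)) {f : E N → ℝ}
    (hf : ContDiffOn ℝ (l.length : ℕ) f Υ) (hη : IsTestFunction Υ η) :
    ∫ x in Υ, f x * listDeriv l η x = (-1) ^ l.length * ∫ x in Υ, listDeriv l f x * η x := by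
  induction l generalizing f with
  | nil => simp
  | cons i l ih =>
    rw [listDeriv_cons, integral_mul_partialDeriv hΥ (hf.of_le (by simp)) (hη.listDeriv l),
      ih (contDiffOn_partialDeriv hΥ hf i), List.length_cons, pow_succ]
    -- Integration by parts moves `i` innermost, whereas `listDeriv (i :: l)` applies it outermost;
    -- symmetry of mixed derivatives reconciles the two.
    have h : Set.EqOn (listDeriv l (partialDeriv i f)) (listDeriv (i :: l) f) Υ := by
      have := listDeriv_perm hΥ (l := l ++ [i]) (l' := i :: l) (f := f)
        (List.perm_append_singleton i l) (by simpa using hf)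
      rwa [listDeriv_append] at this
    rw [setIntegral_congr_fun hΥ.measurableSet (fun x hx => by rw [h hx])]
    ring

end Test

/-! ### Weak derivatives -/

section Weak

variable {Υ : Set (E N)} {α β : MultiIndex N} {v g g' : E N → ℝ}

lemma hasWeakDeriv_classicalDeriv (hΥ : IsOpen Υ) {f : E N → ℝ}
    (hf : ContDiffOn ℝ (MultiIndex.length α : ℕ) f Υ) :
    HasWeakDeriv Υ α f (classicalDeriv α f) := by
  refine ⟨hf.continuousOn.locallyIntegrableOn hΥ.measurableSet,
    (contDiffOn_classicalDeriv (k := 0) hΥ α (by simpa using hf)).continuousOn.locallyIntegrableOn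
      hΥ.measurableSet, fun η hη => ?_⟩
  rw [classicalDeriv_eq_listDeriv, classicalDeriv_eq_listDeriv, ← MultiIndex.length_toList]
  exact integral_mul_listDeriv hΥ _ (by rwa [MultiIndex.length_toList]) hη

lemma ae_eq_zero_of_integral_mul_test (hΥ : IsOpen Υ) (hg : LocallyIntegrableOn g Υ)
    (h : ∀ η, IsTestFunction Υ η → ∫ x in Υ, g x * η x = 0) :
    ∀ᵐ x ∂volume.restrict Υ, g x = 0 := by
  rw [ae_restrict_iff' hΥ.measurableSet]
  refine hΥ.ae_eq_zero_of_integral_contDiff_smul_eq_zero hg fun η h1 h2 h3 => ?_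
  have hη : IsTestFunction Υ η := ⟨h1, h2, h3⟩
  rw [← h η hη, hη.setIntegral]
  simp [mul_comm]

lemma HasWeakDeriv.ae_eq (hΥ : IsOpen Υ) (h : HasWeakDeriv Υ α v g) (h' : HasWeakDeriv Υ α v g') :
    g =ᵐ[volume.restrict Υ] g' := by
  have := ae_eq_zero_of_integral_mul_test (g := g - g') hΥ (h.2.1.sub h'.2.1) fun η hη => ?_
  · filter_upwards [this] with x hx
    simpa [sub_eq_zero] using hx
  · simp only [Pi.sub_apply, sub_mul]
    rw [integral_sub (hη.integrable_mul h.2.1).integrableOn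
      (hη.integrable_mul h'.2.1).integrableOn, sub_eq_zero]
    have h1 := h.2.2 η hη
    rw [h'.2.2 η hη] at h1
    exact (mul_left_cancel₀ (pow_ne_zero _ (by norm_num)) h1).symm

lemma hasWeakDeriv_weakDeriv (h : HasWeakDeriv Υ α v g) :
    HasWeakDeriv Υ α v (weakDeriv Υ α v) := by
  have h' : ∃ g, HasWeakDeriv Υ α v g := ⟨g, h⟩
  unfold weakDeriv
  rw [dif_pos h']
  exact h'.choose_spec

lemma HasWeakDeriv.weakDeriv_ae_eq (hΥ : IsOpen Υ) (h : HasWeakDeriv Υ α v g) :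
    weakDeriv Υ α v =ᵐ[volume.restrict Υ] g :=
  (hasWeakDeriv_weakDeriv h).ae_eq hΥ h

/-- Comparing the definitions at `∂_i η` and at `η` shows that consecutive weak derivatives are
linked by a first-order integration by parts. The mollification argument needs no other link between
them. -/
lemma HasWeakDeriv.integral_mul_partialDeriv (h : HasWeakDeriv Υ α v g) {i : Fin N}
    (h' : HasWeakDeriv Υ (α + Pi.single i 1) v g') {η : E N → ℝ} (hη : IsTestFunction Υ η) :
    ∫ x in Υ, g x * partialDeriv i η x = -∫ x in Υ, g' x * η x := by
  have h1 := h.2.2 _ (hη.partialDeriv i)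
  have h2 := h'.2.2 _ hη
  rw [← classicalDeriv_classicalDeriv hη.1, classicalDeriv_single, h1, MultiIndex.length_add,
    MultiIndex.length_single, pow_succ, mul_assoc] at h2
  simpa using mul_left_cancel₀ (pow_ne_zero _ (by norm_num)) h2

lemma HasWeakDeriv.sub {v' : E N → ℝ} (h : HasWeakDeriv Υ α v g) (h' : HasWeakDeriv Υ α v' g') :
    HasWeakDeriv Υ α (v - v') (g - g') := by
  refine ⟨h.1.sub h'.1, h.2.1.sub h'.2.1, fun η hη => ?_⟩
  simp only [Pi.sub_apply, sub_mul]
  rw [integral_sub ((hη.classicalDeriv α).integrable_mul h.1).integrableOn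
      ((hη.classicalDeriv α).integrable_mul h'.1).integrableOn,
    integral_sub (hη.integrable_mul h.2.1).integrableOn
      (hη.integrable_mul h'.2.1).integrableOn, h.2.2 η hη, h'.2.2 η hη, mul_sub]

end Weak

/-! ### The operator acting on Taylor sums -/

section Operator

variable {N' N'' : ℕ} {Υ : Set (E N)} {d : ℕ} {a : MultiIndex N → Fin N' → Fin N'' → ℝ}
  {u : Fin N' → E N → ℝ}

/-- Testing the equation with `D^β η` expresses that `D^β u` is again a solution, since the
coefficients are constant. All derivatives of order `|β| + d` being functions, the equation holds
almost everywhere by the fundamental lemma of the calculus of variations. -/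
lemma IsDistribSolution.ae_sum_eq_zero (hΥ : IsOpen Υ) (hsol : IsDistribSolution Υ d a u)
    (β : MultiIndex N) (G : MultiIndex N → Fin N' → E N → ℝ)
    (hG : ∀ α, MultiIndex.length α = d → ∀ i, HasWeakDeriv Υ (β + α) (u i) (G (β + α) i))
    (i'' : Fin N'') :
    ∀ᵐ z ∂volume.restrict Υ,
      ∑ i', ∑ α ∈ multiIndices N d, a α i' i'' * G (β + α) i' z = 0 := by
  have hG' : ∀ α ∈ multiIndices N d, ∀ i, HasWeakDeriv Υ (β + α) (u i) (G (β + α) i) :=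
    fun α hα => hG α (mem_multiIndices.1 hα)
  refine ae_eq_zero_of_integral_mul_test hΥ ?_ fun η hη => ?_
  · have : ∀ s : Finset (Fin N' × MultiIndex N), (∀ p ∈ s, p.2 ∈ multiIndices N d) →
        LocallyIntegrableOn (fun z => ∑ p ∈ s, a p.2 p.1 i'' * G (β + p.2) p.1 z) Υ := by
      classical
      intro s
      induction s using Finset.induction_on with
      | empty => intro _; simpa using locallyIntegrableOn_zero
      | insert p s hp ih =>
        intro hs
        simp only [Finset.sum_insert hp]
        refine LocallyIntegrableOn.add ?_ (ih fun q hq => hs q (Finset.mem_insert_of_mem hq))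
        exact (hG' p.2 (hs p (Finset.mem_insert_self _ _)) p.1).2.1.smul (a p.2 p.1 i'')
    have := this (Finset.univ ×ˢ multiIndices N d) (by simp)
    simpa only [Finset.sum_product] using this
  · have h1 := hsol i'' _ (hη.classicalDeriv β)
    simp_rw [Finset.sum_mul]
    rw [integral_finsetSum _ fun i' _ => ?_]
    · have h2 : ∀ i', ∫ x in Υ, ∑ α ∈ multiIndices N d, a α i' i'' * G (β + α) i' x * η x
          = (-1) ^ MultiIndex.length β * ∑ α ∈ multiIndices N d, a α i' i'' *
            ((-1) ^ d * ∫ x in Υ, u i' x * classicalDeriv α (classicalDeriv β η) x) := by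
        intro i'
        rw [integral_finsetSum _ fun α hα => ?_, Finset.mul_sum]
        · refine Finset.sum_congr rfl fun α hα => ?_
          simp_rw [mul_assoc]
          rw [integral_const_mul, classicalDeriv_classicalDeriv hη.1, add_comm α β,
            (hG' α hα i').2.2 η hη, MultiIndex.length_add, mem_multiIndices.1 hα, pow_add]
          have e1 : ((-1 : ℝ) ^ MultiIndex.length β) * (-1) ^ MultiIndex.length β = 1 := by
            rw [← mul_pow]; simp
          have e2 : ((-1 : ℝ) ^ d) * (-1) ^ d = 1 := by
            rw [← mul_pow]; simp
          linear_combination (-(a α i' i'' * ∫ x in Υ, G (β + α) i' x * η x)) *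
            ((-1 : ℝ) ^ d * (-1) ^ d) * e1
            + (-(a α i' i'' * ∫ x in Υ, G (β + α) i' x * η x)) * e2
        · simp_rw [mul_assoc]
          exact (hη.integrable_mul (hG' α hα i').2.1).integrableOn.const_mul _
      simp_rw [h2]
      rw [← Finset.mul_sum, h1, mul_zero]
    · refine integrable_finsetSum _ fun α hα => ?_
      simp_rw [mul_assoc]
      exact (hη.integrable_mul (hG' α hα i').2.1).integrableOn.const_mul _

lemma sum_taylorSum {ι : Type*} (s : Finset ι) (n : ℕ) (G : ι → MultiIndex N → E N → ℝ)
    (z x : E N) :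
    ∑ j ∈ s, taylorSum n (G j) z x = taylorSum n (fun β z => ∑ j ∈ s, G j β z) z x := by
  simp only [taylorSum, Finset.mul_sum, Finset.sum_mul]
  rw [Finset.sum_comm]
  exact Finset.sum_congr rfl fun k _ => Finset.sum_comm

lemma mul_taylorSum (c : ℝ) (n : ℕ) (G : MultiIndex N → E N → ℝ) (z x : E N) :
    c * taylorSum n G z x = taylorSum n (fun β z => c * G β z) z x := by
  simp only [taylorSum, Finset.mul_sum]
  exact Finset.sum_congr rfl fun k _ => Finset.sum_congr rfl fun β _ => by ring

/-- `d`-th order operators act on Taylor polynomials through their coefficients. -/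
lemma sum_taylorSum_eq_zero (m : ℕ) (G : MultiIndex N → Fin N' → E N → ℝ) (z x : E N)
    (i'' : Fin N'')
    (h : ∀ β, MultiIndex.length β + d < m →
      ∑ i', ∑ α ∈ multiIndices N d, a α i' i'' * G (β + α) i' z = 0) :
    ∑ i', ∑ α ∈ multiIndices N d,
      a α i' i'' * taylorSum (m - d) (fun β => G (β + α) i') z x = 0 := by
  simp_rw [mul_taylorSum, sum_taylorSum]
  refine Finset.sum_eq_zero fun k hk => Finset.sum_eq_zero fun β hβ => ?_
  beta_reduce
  rw [h β, mul_zero, zero_mul]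
  rw [mem_multiIndices] at hβ
  have := Finset.mem_range.1 hk
  omega

lemma diffOp_taylorSum (m : ℕ) (G : MultiIndex N → Fin N' → E N → ℝ) (z x : E N) (i'' : Fin N'') :
    diffOp d a (fun i => taylorSum m (fun α => G α i) z) i'' x = ∑ i', ∑ α ∈ multiIndices N d,
      a α i' i'' * taylorSum (m - d) (fun β => G (β + α) i') z x := by
  unfold diffOp
  refine Finset.sum_congr rfl fun i' _ => Finset.sum_congr rfl fun α hα => ?_
  rw [classicalDeriv_taylorSum, mem_multiIndices.1 hα]

/-- Taylor polynomials of classically differentiable solutions are solutions. -/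
lemma diffOp_taylorPoly_eq_zero (hΥ : IsOpen Υ) (hsol : IsDistribSolution Υ d a u) {m : ℕ}
    (hu : ∀ i, ContDiffOn ℝ (m - 1 : ℕ) (u i) Υ) {z : E N} (hz : z ∈ Υ) (i'' : Fin N'') (x : E N) :
    diffOp d a (taylorPoly m u z) i'' x = 0 := by
  have h := diffOp_taylorSum (d := d) (a := a) m (fun α i => classicalDeriv α (u i)) z x i''
  refine Eq.trans h ?_
  refine sum_taylorSum_eq_zero m (fun α i => classicalDeriv α (u i)) z x i'' fun β hβ => ?_
  have hle : ∀ α, MultiIndex.length α = d → MultiIndex.length (β + α) ≤ m - 1 := by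
    intro α hα
    rw [MultiIndex.length_add]
    omega
  have hae := hsol.ae_sum_eq_zero hΥ β (fun α i => classicalDeriv α (u i))
    (fun α hα i => hasWeakDeriv_classicalDeriv hΥ ((hu i).of_le (by exact_mod_cast hle α hα))) i''
  -- The derivatives involved have order at most `m - 1`, hence are continuous, and the almost
  -- everywhere identity holds at every point of the open set.
  have heq : Set.EqOn (fun z => ∑ i', ∑ α ∈ multiIndices N d,
      a α i' i'' * classicalDeriv (β + α) (u i') z) (fun _ => 0) Υ := by
    refine Measure.eqOn_of_ae_eq hae ?_ continuousOn_const ?_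
    · refine continuousOn_finsetSum _ fun i' _ => continuousOn_finsetSum _ fun α hα => ?_
      refine continuousOn_const.mul ?_
      refine (contDiffOn_classicalDeriv (k := 0) hΥ (β + α) ((hu i').of_le ?_)).continuousOn
      rw [zero_add]
      exact_mod_cast hle α (mem_multiIndices.1 hα)
    · rw [hΥ.interior_eq]
      exact subset_closure
  exact heq hz

end Operator

/-! ### Averaged Taylor polynomials -/

/-- The averaged Taylor polynomial built from a family `G` of derivatives. -/
noncomputable def averagedTaylorSum (B : Set (E N)) (m : ℕ) (G : MultiIndex N → E N → ℝ)
    (x : E N) : ℝ :=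
  (volume.real B)⁻¹ * ∫ z in B, taylorSum m G z x

section Average

variable {B : Set (E N)} {m : ℕ} {G : MultiIndex N → E N → ℝ}

lemma integrableOn_taylorSum (hB : MeasurableSet B) (hb : Bornology.IsBounded B)
    (hG : ∀ α, MultiIndex.length α < m → IntegrableOn (G α) B) (x : E N) :
    IntegrableOn (fun z => taylorSum m G z x) B := by
  unfold taylorSum
  refine integrable_finsetSum _ fun k hk => integrable_finsetSum _ fun α hα => ?_
  rw [mem_multiIndices] at hα
  rw [Finset.mem_range] at hk
  refine IntegrableOn.mul_continuousOn_of_subset (K := closure B) ?_ ?_ hB hb.isCompact_closure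
    subset_closure
  · exact (hG α (by omega)).const_mul _
  · have := (contDiff_monomial α).continuous
    fun_prop

/-- After recentring at `y`, the dependence on `x` is through monomials `(x - y)^α` that do not
involve `z`, so the average passes to the coefficients. Smoothness, degree and derivatives of the
average follow from those of a Taylor sum. -/
lemma averagedTaylorSum_eq_taylorSum (hB : MeasurableSet B) (hb : Bornology.IsBounded B)
    (hG : ∀ α, MultiIndex.length α < m → IntegrableOn (G α) B) (y : E N) :
    averagedTaylorSum B m G = taylorSum m (fun α y =>
      averagedTaylorSum B (m - MultiIndex.length α) (fun β => G (β + α)) y) y := by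
  funext x
  have hint : ∀ α, MultiIndex.length α < m → Integrable (fun z =>
      taylorSum (m - MultiIndex.length α) (fun β => G (β + α)) z y) (volume.restrict B) := by
    intro α _
    refine integrableOn_taylorSum hB hb (fun β hβ => hG _ ?_) y
    rw [MultiIndex.length_add]
    omega
  unfold averagedTaylorSum
  simp_rw [taylorSum_recenter m G y _ x]
  have hlt : ∀ k ∈ Finset.range m, ∀ α ∈ multiIndices N k, MultiIndex.length α < m := by
    intro k hk α hα
    rw [mem_multiIndices] at hα
    rw [Finset.mem_range] at hk
    omega
  rw [show ∀ H : MultiIndex N → E N → ℝ, taylorSum m H y x = ∑ k ∈ Finset.range m,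
    ∑ α ∈ multiIndices N k, 1 / (MultiIndex.fact α : ℝ) * H α y * monomial α (x - y)
    from fun _ => rfl]
  have h2 : ∀ z, taylorSum m (fun α y => taylorSum (m - MultiIndex.length α)
      (fun β => G (β + α)) z y) y x = ∑ k ∈ Finset.range m,
    ∑ α ∈ multiIndices N k, 1 / (MultiIndex.fact α : ℝ) * taylorSum (m - MultiIndex.length α)
      (fun β => G (β + α)) z y * monomial α (x - y) := fun _ => rfl
  simp_rw [h2]
  rw [integral_finsetSum _ fun k hk => integrable_finsetSum _ fun α hα =>
    ((hint α (hlt k hk α hα)).const_mul _).mul_const _, Finset.mul_sum]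
  refine Finset.sum_congr rfl fun k hk => ?_
  rw [integral_finsetSum _ fun α hα => ((hint α (hlt k hk α hα)).const_mul _).mul_const _,
    Finset.mul_sum]
  refine Finset.sum_congr rfl fun α hα => ?_
  rw [integral_mul_const, integral_const_mul]
  ring

lemma contDiff_averagedTaylorSum (hB : MeasurableSet B) (hb : Bornology.IsBounded B)
    (hG : ∀ α, MultiIndex.length α < m → IntegrableOn (G α) B) :
    ContDiff ℝ ∞ (averagedTaylorSum B m G) := by
  rw [averagedTaylorSum_eq_taylorSum hB hb hG 0]
  exact contDiff_taylorSum _ _ _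

lemma isPolyOfDegreeLE_averagedTaylorSum (hB : MeasurableSet B) (hb : Bornology.IsBounded B)
    (hG : ∀ α, MultiIndex.length α < m → IntegrableOn (G α) B) :
    IsPolyOfDegreeLE (m - 1) (averagedTaylorSum B m G) := by
  rw [averagedTaylorSum_eq_taylorSum hB hb hG 0]
  exact isPolyOfDegreeLE_taylorSum _ _ _

lemma classicalDeriv_averagedTaylorSum (hB : MeasurableSet B) (hb : Bornology.IsBounded B)
    (hG : ∀ α, MultiIndex.length α < m → IntegrableOn (G α) B) (α : MultiIndex N) :
    classicalDeriv α (averagedTaylorSum B m G)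
      = averagedTaylorSum B (m - MultiIndex.length α) (fun β => G (β + α)) := by
  have hG' : ∀ β, MultiIndex.length β < m - MultiIndex.length α →
      IntegrableOn (G (β + α)) B := by
    intro β hβ
    refine hG _ ?_
    rw [MultiIndex.length_add]
    omega
  rw [averagedTaylorSum_eq_taylorSum hB hb hG 0, averagedTaylorSum_eq_taylorSum hB hb hG' 0,
    classicalDeriv_taylorSum]
  congr 1
  funext β x
  simp only [MultiIndex.length_add, Nat.sub_sub, add_assoc, add_comm (MultiIndex.length α)]

end Average

/-! ### Sobolev functions and their averaged Taylor polynomials -/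

section Sobolev

variable {N' N'' : ℕ} {Υ : Set (E N)} {d : ℕ} {a : MultiIndex N → Fin N' → Fin N'' → ℝ}
  {u : Fin N' → E N → ℝ}

lemma MemH.hasWeakDeriv {k : ℕ} (hu : MemH Υ k u) {α : MultiIndex N}
    (hα : MultiIndex.length α ≤ k) (i : Fin N') :
    HasWeakDeriv Υ α (u i) (weakDeriv Υ α (u i)) := by
  obtain ⟨g, hg, _⟩ := hu.2 i α hα
  exact hasWeakDeriv_weakDeriv hg

lemma MemH.memLp_weakDeriv (hΥ : IsOpen Υ) {k : ℕ} (hu : MemH Υ k u) {α : MultiIndex N}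
    (hα : MultiIndex.length α ≤ k) (i : Fin N') :
    MemLp (weakDeriv Υ α (u i)) 2 (volume.restrict Υ) := by
  obtain ⟨g, hg, hg2⟩ := hu.2 i α hα
  exact hg2.ae_eq (hg.weakDeriv_ae_eq hΥ).symm

lemma integrableOn_of_memLp_two {B : Set (E N)} (hb : Bornology.IsBounded Υ) (hBΥ : B ⊆ Υ)
    {g : E N → ℝ} (hg : MemLp g 2 (volume.restrict Υ)) : IntegrableOn g B := by
  have : IsFiniteMeasure (volume.restrict Υ) := ⟨by
    rw [Measure.restrict_apply_univ]; exact hb.measure_lt_top⟩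
  exact IntegrableOn.mono_set (hg.integrable (by norm_num)) hBΥ

/-- Averaged Taylor polynomials of Sobolev solutions are solutions. -/
lemma diffOp_averagedTaylor_eq_zero (hΥ : IsOpen Υ) (hb : Bornology.IsBounded Υ)
    (hsol : IsDistribSolution Υ d a u) {m : ℕ} (hm : 1 ≤ m) (hu : MemH Υ (m - 1) u)
    {B : Set (E N)} (hB : MeasurableSet B) (hBΥ : B ⊆ Υ) (i'' : Fin N'') (x : E N) :
    diffOp d a (averagedTaylor Υ B m u) i'' x = 0 := by
  have hint : ∀ i α, MultiIndex.length α < m → IntegrableOn (weakDeriv Υ α (u i)) B :=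
    fun i α hα => integrableOn_of_memLp_two hb hBΥ (hu.memLp_weakDeriv hΥ (by omega) i)
  have hbB := hb.subset hBΥ
  have h1 : diffOp d a (averagedTaylor Υ B m u) i'' x = ∑ i', ∑ α ∈ multiIndices N d,
      a α i' i'' * averagedTaylorSum B (m - d) (fun β => weakDeriv Υ (β + α) (u i')) x := by
    unfold diffOp
    refine Finset.sum_congr rfl fun i' _ => Finset.sum_congr rfl fun α hα => ?_
    have := classicalDeriv_averagedTaylorSum hB hbB (hint i') α
    rw [mem_multiIndices.1 hα] at this
    rw [← this]
    rfl
  have hint2 : ∀ i', ∀ α ∈ multiIndices N d, Integrable (fun z =>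
      a α i' i'' * taylorSum (m - d) (fun β => weakDeriv Υ (β + α) (u i')) z x)
      (volume.restrict B) := by
    intro i' α hα
    refine (integrableOn_taylorSum hB hbB (fun β hβ => hint i' _ ?_) x).const_mul _
    rw [MultiIndex.length_add, mem_multiIndices.1 hα]
    omega
  have h2 : diffOp d a (averagedTaylor Υ B m u) i'' x = (volume.real B)⁻¹ * ∫ z in B,
      ∑ i', ∑ α ∈ multiIndices N d,
        a α i' i'' * taylorSum (m - d) (fun β => weakDeriv Υ (β + α) (u i')) z x := by
    rw [h1, integral_finsetSum _ fun i' _ => integrable_finsetSum _ (hint2 i'), Finset.mul_sum]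
    refine Finset.sum_congr rfl fun i' _ => ?_
    rw [integral_finsetSum _ (hint2 i'), Finset.mul_sum]
    refine Finset.sum_congr rfl fun α _ => ?_
    rw [integral_const_mul, averagedTaylorSum]
    ring
  -- Only finitely many `β` occur, so one null set serves for all of them.
  have hae : ∀ᵐ z ∂volume.restrict Υ, ∀ k ∈ Finset.range (m - d), ∀ β ∈ multiIndices N k,
      ∑ i', ∑ α ∈ multiIndices N d, a α i' i'' * weakDeriv Υ (β + α) (u i') z = 0 := by
    rw [Finset.eventually_all]
    intro k hk
    rw [Finset.eventually_all]
    intro β hβ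
    refine hsol.ae_sum_eq_zero hΥ β (fun α i => weakDeriv Υ α (u i)) (fun α hα i => ?_) i''
    refine hu.hasWeakDeriv ?_ i
    rw [Finset.mem_range] at hk
    rw [MultiIndex.length_add, hα, mem_multiIndices.1 hβ]
    omega
  rw [h2, integral_eq_zero_of_ae, mul_zero]
  filter_upwards [ae_mono (Measure.restrict_mono hBΥ le_rfl) hae] with z hz
  refine sum_taylorSum_eq_zero m (fun α i => weakDeriv Υ α (u i)) z x i'' fun β hβ => ?_
  exact hz _ (Finset.mem_range.2 (by omega)) β (mem_multiIndices.2 rfl)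

lemma memLp_of_continuous_of_isBounded (hΥo : MeasurableSet Υ)
    (hΥ : Bornology.IsBounded Υ) {f : E N → ℝ} (hf : Continuous f) : MemLp f 2 (volume.restrict Υ) := by
  have : IsFiniteMeasure (volume.restrict Υ) := ⟨by
    rw [Measure.restrict_apply_univ]; exact hΥ.measure_lt_top⟩
  obtain ⟨C, hC⟩ := hΥ.isCompact_closure.exists_bound_of_continuousOn hf.continuousOn
  refine MemLp.of_bound hf.aestronglyMeasurable C ?_
  filter_upwards [ae_restrict_mem hΥo] with x hx
  exact hC x (subset_closure hx)

lemma hasWeakDeriv_sub_contDiff (hΥ : IsOpen Υ) {v P : E N → ℝ} (hP : ContDiff ℝ ∞ P)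
    {α : MultiIndex N} {g : E N → ℝ} (h : HasWeakDeriv Υ α v g) :
    HasWeakDeriv Υ α (v - P) (g - classicalDeriv α P) :=
  h.sub (hasWeakDeriv_classicalDeriv hΥ (hP.of_le (by exact_mod_cast le_top)).contDiffOn)

end Sobolev

/-! ### Integrals along segments -/

lemma lintegral_comp_add_smul {f : E N → ℝ≥0∞} (hf : Measurable f) (w : E N) {c : ℝ}
    (hc : 0 < c) :
    ∫⁻ x, f (w + c • x) = ENNReal.ofReal ((c ^ N)⁻¹) * ∫⁻ x, f x := by
  have h1 : ∫⁻ x, f (w + c • x) = ∫⁻ x, f (w + x) ∂(Measure.map (fun x : E N => c • x) volume) := by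
    rw [lintegral_map (by fun_prop) (by fun_prop)]
  rw [h1, Measure.map_addHaar_smul _ hc.ne', lintegral_smul_measure,
    lintegral_add_left_eq_self (μ := volume) f w]
  simp [abs_of_pos hc]

/-- The map `(x, z) ↦ z + t(x - z)` is an affine change of variables in either argument. For `t ≥
ρ`, changing `x` costs `t^{-N} ≤ ρ^{-N}` and the free `z` contributes `|B|`. For `t < ρ`, changing
`z` costs `(1 - t)^{-N} ≤ (1 - ρ)^{-N}`, and the free `x` contributes `|Υ| ≤ ((1 - ρ)/ρ)^N |B|` by
the inclusion in the ball of radius `(1 - ρ)h`. Splitting at `t = ρ` makes the two bounds coincide.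
-/
lemma lintegral_segment_le {Υ : Set (E N)} {y : E N} {h ρ : ℝ} (hh : 0 < h) (hρ : 0 < ρ)
    (hρ1 : ρ < 1) (hΥ : Υ ⊆ Metric.closedBall y ((1 - ρ) * h)) {f : E N → ℝ≥0∞}
    (hf : Measurable f) {t : ℝ} (ht : t ∈ Set.Ioo (0 : ℝ) 1) :
    ∫⁻ z in Metric.ball y (ρ * h), ∫⁻ x in Υ, f (z + t • (x - z))
      ≤ volume (Metric.ball y (ρ * h)) * ENNReal.ofReal ((ρ ^ N)⁻¹) * ∫⁻ x, f x := by
  rcases le_or_gt ρ t with htρ | htρ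
  · have h1 : ∀ z : E N, ∫⁻ x in Υ, f (z + t • (x - z))
        ≤ ENNReal.ofReal ((ρ ^ N)⁻¹) * ∫⁻ x, f x := by
      intro z
      refine (setLIntegral_le_lintegral _ _).trans ?_
      have : ∀ x : E N, z + t • (x - z) = (z - t • z) + t • x := fun x => by
        rw [smul_sub]; abel
      simp_rw [this]
      rw [lintegral_comp_add_smul hf _ ht.1]
      gcongr
    refine (lintegral_mono h1).trans ?_
    rw [lintegral_const, Measure.restrict_apply_univ, mul_comm, mul_assoc]
  · rw [lintegral_lintegral_swap (by
      have : Measurable fun p : E N × E N => f (p.1 + t • (p.2 - p.1)) :=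
        hf.comp (by fun_prop)
      exact this.aemeasurable)]
    have h1 : ∀ x : E N, ∫⁻ z in Metric.ball y (ρ * h), f (z + t • (x - z))
        ≤ ENNReal.ofReal (((1 - ρ) ^ N)⁻¹) * ∫⁻ x, f x := by
      intro x
      refine (setLIntegral_le_lintegral _ _).trans ?_
      have : ∀ z : E N, z + t • (x - z) = t • x + (1 - t) • z := fun z => by
        rw [smul_sub, sub_smul, one_smul]; abel
      simp_rw [this]
      rw [lintegral_comp_add_smul hf _ (by linarith [ht.2])]
      gcongr
    refine (lintegral_mono h1).trans ?_
    rw [lintegral_const, Measure.restrict_apply_univ, mul_comm, ← mul_assoc]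
    refine mul_le_mul_left ?_ _
    refine (mul_le_mul_left (measure_mono hΥ) _).trans ?_
    have h1ρ : 0 < 1 - ρ := by linarith
    rw [Measure.addHaar_closedBall _ _ (by positivity), Measure.addHaar_ball_of_pos _ y (by positivity),
      mul_right_comm _ (volume _), mul_right_comm _ (volume _), ← ENNReal.ofReal_mul (by positivity),
      ← ENNReal.ofReal_mul (by positivity), finrank_euclideanSpace_fin]
    refine mul_le_mul_left (le_of_eq ?_) _
    congr 1
    field_simp
    rw [mul_pow, mul_pow]
    ring

/-- The integral of `f` along the segment joining the two components of `p`. -/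
noncomputable def segmentIntegral (f : E N → ℝ≥0∞) (p : E N × E N) : ℝ≥0∞ :=
  ∫⁻ t in Set.Ioo (0 : ℝ) 1, f (p.2 + t • (p.1 - p.2))

lemma measurable_segment_comp {f : E N → ℝ≥0∞} (hf : Measurable f) :
    Measurable fun q : (E N × E N) × ℝ => f (q.1.2 + q.2 • (q.1.1 - q.1.2)) :=
  hf.comp (by fun_prop)

lemma measurable_segmentIntegral {f : E N → ℝ≥0∞} (hf : Measurable f) :
    Measurable (segmentIntegral f) :=
  (measurable_segment_comp hf).lintegral_prod_right'

lemma lintegral_segmentIntegral_le {Υ : Set (E N)} {y : E N} {h ρ : ℝ} (hh : 0 < h) (hρ : 0 < ρ)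
    (hρ1 : ρ < 1) (hΥ : Υ ⊆ Metric.closedBall y ((1 - ρ) * h)) {f : E N → ℝ≥0∞}
    (hf : Measurable f) :
    ∫⁻ p, segmentIntegral f p
        ∂((volume.restrict Υ).prod (volume.restrict (Metric.ball y (ρ * h))))
      ≤ volume (Metric.ball y (ρ * h)) * ENNReal.ofReal ((ρ ^ N)⁻¹) * ∫⁻ x, f x := by
  unfold segmentIntegral
  rw [lintegral_lintegral_swap (measurable_segment_comp hf).aemeasurable]
  refine (setLIntegral_mono' measurableSet_Ioo (fun t ht => ?_)).trans (b := ∫⁻ _ in Set.Ioo (0 : ℝ) 1,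
    volume (Metric.ball y (ρ * h)) * ENNReal.ofReal ((ρ ^ N)⁻¹) * ∫⁻ x, f x) ?_
  · rw [lintegral_prod_symm _ (by
      have : Measurable fun p : E N × E N => f (p.2 + t • (p.1 - p.2)) := hf.comp (by fun_prop)
      exact this.aemeasurable)]
    exact lintegral_segment_le hh hρ hρ1 hΥ hf ht
  · simp

/-- From `x`, continue through the centre `y` to a point of the small ball at distance `r` beyond
it. Both ends lie in `Υ`, so `‖x - y‖ + r` is at most the diameter; let `r` increase to the radius.
-/
lemma subset_closedBall_of_ball_subset {Υ : Set (E N)} (hb : Bornology.IsBounded Υ) {y : E N}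
    {ρ : ℝ} (hρ : 0 < ρ) (hρ1 : ρ < 1) (hB : Metric.ball y (ρ * Metric.diam Υ) ⊆ Υ)
    (hd : 0 < Metric.diam Υ) :
    Υ ⊆ Metric.closedBall y ((1 - ρ) * Metric.diam Υ) := by
  intro x hx
  rw [Metric.mem_closedBall]
  rcases eq_or_ne x y with rfl | hxy
  · rw [dist_self]; exact mul_nonneg (by linarith) hd.le
  have hn : 0 < ‖x - y‖ := norm_pos_iff.2 (sub_ne_zero.2 hxy)
  have key : ∀ r, 0 ≤ r → r < ρ * Metric.diam Υ → ‖x - y‖ + r ≤ Metric.diam Υ := by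
    intro r hr0 hr
    have hmem : y - (r / ‖x - y‖) • (x - y) ∈ Υ := by
      apply hB
      rw [Metric.mem_ball, dist_eq_norm]
      have : y - (r / ‖x - y‖) • (x - y) - y = -((r / ‖x - y‖) • (x - y)) := by abel
      rw [this, norm_neg, norm_smul, Real.norm_of_nonneg (by positivity),
        div_mul_cancel₀ _ hn.ne']
      exact hr
    have h1 := Metric.dist_le_diam_of_mem hb hx hmem
    rw [dist_eq_norm] at h1
    have : x - (y - (r / ‖x - y‖) • (x - y)) = (1 + r / ‖x - y‖) • (x - y) := by
      rw [add_smul, one_smul]; abel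
    rw [this, norm_smul, Real.norm_of_nonneg (by positivity), add_mul, one_mul,
      div_mul_cancel₀ _ hn.ne'] at h1
    exact h1
  rw [dist_eq_norm]
  have h2 : ρ * Metric.diam Υ ≤ Metric.diam Υ - ‖x - y‖ := by
    refine le_of_forall_lt fun r hr => ?_
    rcases le_or_gt 0 r with h0 | h0
    · obtain ⟨s, hs1, hs2⟩ := exists_between hr
      have := key s (h0.trans hs1.le) hs2
      linarith
    · have := key 0 le_rfl (by positivity)
      linarith
  linarith

/-! ### Mollification -/

/-- Translations are continuous in `L¹`. -/
lemma tendsto_lintegral_translate_sub {g : E N → ℝ} (hg : Integrable g) :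
    Filter.Tendsto (fun τ : E N => ∫⁻ x, ‖g (x - τ) - g x‖ₑ) (nhds 0) (nhds 0) := by
  have hL : MemLp g 1 (volume : Measure (E N)) := memLp_one_iff_integrable.2 hg
  let T : C(E N, C(E N, E N)) :=
    (ContinuousMap.mk (fun q : E N × E N => q.2 - q.1) (by fun_prop)).curry
  have hT : ∀ τ, MeasurePreserving (T τ) (volume : Measure (E N)) volume := fun τ =>
    measurePreserving_sub_right volume τ
  have hc : Continuous fun τ => Lp.compMeasurePreserving (T τ) (hT τ) (hL.toLp g) :=
    continuous_const.compMeasurePreservingLp T.continuous hT (by simp)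
  have h1 := (tendsto_iff_edist_tendsto_0.1 (hc.tendsto 0))
  refine h1.congr fun τ => ?_
  rw [Lp.toLp_compMeasurePreserving, Lp.toLp_compMeasurePreserving, Lp.edist_toLp_toLp,
    eLpNorm_one_eq_lintegral_enorm]
  refine lintegral_congr fun x => ?_
  simp [T]

/-- Mollification of `g` by the normalised bump function `ψ`. -/
noncomputable def mollify (ψ : ContDiffBump (0 : E N)) (g : E N → ℝ) : E N → ℝ :=
  convolution g (ψ.normed volume) (ContinuousLinearMap.mul ℝ ℝ) volume

section Mollify

variable {ψ : ContDiffBump (0 : E N)} {g : E N → ℝ}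

lemma contDiff_mollify (hg : Integrable g) : ContDiff ℝ ∞ (mollify ψ g) :=
  ψ.hasCompactSupport_normed.contDiff_convolution_right _ hg.locallyIntegrable ψ.contDiff_normed

/-- As `ψ` has integral one, the error is a `ψ`-average of translation differences; Tonelli bounds
its `L¹` norm by the worst translation within the support of `ψ`. -/
lemma lintegral_mollify_sub_le (hm : Measurable g) (hg : Integrable g) {ε : ℝ≥0∞}
    (hε : ∀ τ : E N, ‖τ‖ < ψ.rOut → ∫⁻ x, ‖g (x - τ) - g x‖ₑ ≤ ε) :
    ∫⁻ x, ‖mollify ψ g x - g x‖ₑ ≤ ε := by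
  have hψm : Measurable (ψ.normed volume) := ψ.continuous_normed.measurable
  have h1 : ∀ x, mollify ψ g x - g x = ∫ τ, ψ.normed volume τ * (g (x - τ) - g x) := by
    intro x
    have hi : Integrable fun τ => g (x - τ) * ψ.normed volume τ :=
      (ψ.hasCompactSupport_normed.convolutionExists_right (ContinuousLinearMap.mul ℝ ℝ)
        hg.locallyIntegrable ψ.continuous_normed x).integrable_swap
    have h2 : mollify ψ g x = ∫ τ, g (x - τ) * ψ.normed volume τ := convolution_eq_swap _
    have h3 : ∀ τ, ψ.normed volume τ * (g (x - τ) - g x)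
        = g (x - τ) * ψ.normed volume τ - g x * ψ.normed volume τ := fun τ => by ring
    simp_rw [h3]
    rw [integral_sub hi (ψ.integrable_normed.const_mul _), integral_const_mul, h2,
      ψ.integral_normed, mul_one]
  calc ∫⁻ x, ‖mollify ψ g x - g x‖ₑ
      ≤ ∫⁻ x, ∫⁻ τ, ‖ψ.normed volume τ * (g (x - τ) - g x)‖ₑ := by
        refine lintegral_mono fun x => ?_
        rw [h1]
        exact enorm_integral_le_lintegral_enorm _
    _ = ∫⁻ τ, ∫⁻ x, ‖ψ.normed volume τ * (g (x - τ) - g x)‖ₑ := by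
        refine lintegral_lintegral_swap ?_
        have : Measurable fun p : E N × E N =>
            ‖ψ.normed volume p.2 * (g (p.1 - p.2) - g p.1)‖ₑ := by fun_prop
        exact this.aemeasurable
    _ ≤ ∫⁻ τ, ‖ψ.normed volume τ‖ₑ * ε := by
        refine lintegral_mono fun τ => ?_
        simp_rw [enorm_mul]
        rw [lintegral_const_mul' _ _ (by simp)]
        rcases lt_or_ge ‖τ‖ ψ.rOut with h | h
        · gcongr
          exact hε τ h
        · have : ψ.normed volume τ = 0 := by
            rw [← Function.notMem_support, ψ.support_normed_eq]
            simpa using h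
          simp [this]
    _ = ε := by
        rw [lintegral_mul_const _ (by fun_prop)]
        have : ∫⁻ τ, ‖ψ.normed volume τ‖ₑ = 1 := by
          rw [← ofReal_integral_norm_eq_lintegral_enorm ψ.integrable_normed]
          simp_rw [Real.norm_of_nonneg (ψ.nonneg_normed _)]
          rw [ψ.integral_normed, ENNReal.ofReal_one]
        rw [this, one_mul]

lemma tendsto_lintegral_mollify_sub {ψ : ℕ → ContDiffBump (0 : E N)}
    (hψ : Filter.Tendsto (fun k => (ψ k).rOut) Filter.atTop (nhds 0)) (hm : Measurable g)
    (hg : Integrable g) :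
    Filter.Tendsto (fun k => ∫⁻ x, ‖mollify (ψ k) g x - g x‖ₑ) Filter.atTop (nhds 0) := by
  rw [ENNReal.tendsto_nhds_zero]
  intro ε hε
  have h1 := (ENNReal.tendsto_nhds_zero.1 (tendsto_lintegral_translate_sub hg)) ε hε
  obtain ⟨δ, hδ, h2⟩ := Metric.eventually_nhds_iff.1 h1
  filter_upwards [hψ.eventually_lt_const hδ] with k hk
  refine lintegral_mollify_sub_le hm hg fun τ hτ => h2 ?_
  rw [dist_zero_right]
  exact hτ.trans hk

/-- The function `q ↦ ψ(p - q)` is an admissible test function as soon as the closed ball around `p`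
lies in `Υ`. The minus sign from differentiating in `q` cancels the one from integration by parts.
-/
lemma partialDeriv_mollify {Υ : Set (E N)} {g' : E N → ℝ} {i : Fin N} (hg : Integrable g)
    (hgg' : ∀ η, IsTestFunction Υ η → ∫ x, g x * partialDeriv i η x = -∫ x, g' x * η x)
    {p : E N} (hp : Metric.closedBall p ψ.rOut ⊆ Υ) :
    partialDeriv i (mollify ψ g) p = mollify ψ g' p := by
  have hψ1 : ContDiff ℝ 1 (ψ.normed (volume : Measure (E N))) := ψ.contDiff_normed
  have h1 := ψ.hasCompactSupport_normed.hasFDerivAt_convolution_right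
    (ContinuousLinearMap.mul ℝ ℝ) hg.locallyIntegrable hψ1 p
  have hη : IsTestFunction Υ fun q => ψ.normed volume (p - q) := by
    have hs : tsupport (fun q => ψ.normed (volume : Measure (E N)) (p - q))
        ⊆ Metric.closedBall p ψ.rOut := by
      refine closure_minimal (fun q hq => ?_) Metric.isClosed_closedBall
      have : p - q ∈ Function.support (ψ.normed (volume : Measure (E N))) := hq
      rw [ψ.support_normed_eq, Metric.mem_ball, dist_zero_right] at this
      rw [Metric.mem_closedBall, dist_comm, dist_eq_norm]
      exact this.le
    refine ⟨ψ.contDiff_normed.comp (contDiff_const.sub contDiff_id), ?_, hs.trans hp⟩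
    exact (isCompact_closedBall p ψ.rOut).of_isClosed_subset (isClosed_tsupport _) hs
  have h2 := hgg' _ hη
  have h3 : ∀ q, partialDeriv i (fun q => ψ.normed volume (p - q)) q
      = -(fderiv ℝ (ψ.normed volume) (p - q) (EuclideanSpace.single i 1)) := by
    intro q
    have hd : HasFDerivAt (ψ.normed (volume : Measure (E N))) _ (p - q) :=
      (hψ1.differentiable (by simp)).differentiableAt.hasFDerivAt
    have hd2 : HasFDerivAt (fun q : E N => p - q) (-ContinuousLinearMap.id ℝ (E N)) q :=
      (hasFDerivAt_id q).const_sub p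
    have hd3 := hd.comp q hd2
    have := (hd3.hasLineDerivAt (EuclideanSpace.single i 1)).lineDeriv
    unfold partialDeriv
    refine Eq.trans this ?_
    simp
  simp_rw [h3, mul_neg] at h2
  rw [integral_neg, neg_inj] at h2
  have h4 : DifferentiableAt ℝ (mollify ψ g) p := h1.differentiableAt
  rw [partialDeriv_eq_fderiv h4]
  have h5 : fderiv ℝ (mollify ψ g) p = _ := h1.fderiv
  rw [h5, convolution_precompR_apply _ hg.locallyIntegrable (ψ.hasCompactSupport_normed.fderiv ℝ)
    (hψ1.continuous_fderiv one_ne_zero)]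
  exact h2

end Mollify

/-! ### Taylor's formula for mollified weak jets -/

/-- `G` behaves like the family of weak derivatives, up to order `n`, of the function `G 0`. -/
structure IsWeakJet (Υ : Set (E N)) (n : ℕ) (G : MultiIndex N → E N → ℝ) : Prop where
  measurable : ∀ α, Measurable (G α)
  integrable : ∀ α, MultiIndex.length α ≤ n → Integrable (G α)
  integral_mul_partialDeriv : ∀ α, MultiIndex.length α < n → ∀ i η, IsTestFunction Υ η →
    ∫ x, G α x * partialDeriv i η x = -∫ x, G (α + Pi.single i 1) x * η x

section Jet

variable {Υ : Set (E N)} {n : ℕ} {G : MultiIndex N → E N → ℝ}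

lemma IsWeakJet.taylor_mollify (hG : IsWeakJet Υ n G) (hn : 1 ≤ n) {ψ : ContDiffBump (0 : E N)}
    {z v : E N} (hψ : ∀ t ∈ Set.Icc (0 : ℝ) 1, Metric.closedBall (z + t • v) ψ.rOut ⊆ Υ) :
    mollify ψ (G 0) (z + v) - taylorSum n (fun α => mollify ψ (G α)) z (z + v)
      = ∫ t in (0 : ℝ)..1, n * (1 - t) ^ (n - 1) * ∑ β ∈ multiIndices N n,
        1 / (MultiIndex.fact β : ℝ) * mollify ψ (G β) (z + t • v) * monomial β v := by
  refine taylor_formula n (fun α => mollify ψ (G α)) z v (fun α hα t ht => ?_) (fun α hα => ?_) hn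
  · have hd : DifferentiableAt ℝ (mollify ψ (G α)) (z + t • v) :=
      ((contDiff_mollify (hG.integrable α hα.le)).differentiable (by simp)).differentiableAt
    have h1 : HasDerivAt (fun s : ℝ => z + s • v) v t := by
      simpa using ((hasDerivAt_id t).smul_const v).const_add z
    have h2 := hd.hasFDerivAt.comp_hasDerivAt t h1
    rw [fderiv_eq_sum_partialDeriv hd] at h2
    refine h2.congr_deriv (Finset.sum_congr rfl fun i _ => ?_)
    rw [partialDeriv_mollify (hG.integrable α hα.le)
      (hG.integral_mul_partialDeriv α hα i) (hψ t ht)]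
  · have := (contDiff_mollify (ψ := ψ) (hG.integrable α hα.le)).continuous
    fun_prop

lemma abs_monomial_le (β : MultiIndex N) {v : E N} {h : ℝ} (hv : ‖v‖ ≤ h) :
    |monomial β v| ≤ h ^ MultiIndex.length β := by
  unfold monomial MultiIndex.length
  rw [Finset.abs_prod, ← Finset.prod_pow_eq_pow_sum]
  refine Finset.prod_le_prod (fun _ _ => abs_nonneg _) fun i _ => ?_
  rw [abs_pow]
  gcongr
  exact (PiLp.norm_apply_le v i).trans hv

/-- The constant in front of the derivative of index `β` in the remainder estimate. -/
noncomputable def remainderConst (n : ℕ) (h : ℝ) (β : MultiIndex N) : ℝ :=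
  n * (1 / (MultiIndex.fact β : ℝ)) * h ^ n

/-- In the integral remainder, `(1 - t)^{n-1}` is bounded by one and `|(x - z)^β|` by `h^n`. -/
lemma IsWeakJet.enorm_mollify_sub_le (hG : IsWeakJet Υ n G) (hn : 1 ≤ n)
    {ψ : ContDiffBump (0 : E N)} {x z : E N} {h : ℝ} (hxz : ‖x - z‖ ≤ h)
    (hψ : ∀ t ∈ Set.Icc (0 : ℝ) 1, Metric.closedBall (z + t • (x - z)) ψ.rOut ⊆ Υ) :
    ‖mollify ψ (G 0) x - taylorSum n (fun α => mollify ψ (G α)) z x‖ₑ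
      ≤ ∑ β ∈ multiIndices N n, ENNReal.ofReal (remainderConst n h β) *
        segmentIntegral (fun q => ‖mollify ψ (G β) q‖ₑ) (x, z) := by
  have h1 := hG.taylor_mollify hn hψ
  rw [add_sub_cancel] at h1
  have hc : ∀ β ∈ multiIndices N n, Continuous (mollify ψ (G β)) := fun β hβ =>
    (contDiff_mollify (hG.integrable β (mem_multiIndices.1 hβ).le)).continuous
  have h0 : 0 ≤ h := (norm_nonneg _).trans hxz
  rw [h1, intervalIntegral.integral_of_le zero_le_one, integral_Ioc_eq_integral_Ioo]
  refine (enorm_integral_le_lintegral_enorm _).trans ?_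
  have h2 : ∀ t ∈ Set.Ioo (0 : ℝ) 1, ‖n * (1 - t) ^ (n - 1) * ∑ β ∈ multiIndices N n,
      1 / (MultiIndex.fact β : ℝ) * mollify ψ (G β) (z + t • (x - z)) * monomial β (x - z)‖ₑ
      ≤ ∑ β ∈ multiIndices N n, ENNReal.ofReal (remainderConst n h β) *
        ‖mollify ψ (G β) (z + t • (x - z))‖ₑ := by
    intro t ht
    rw [Finset.mul_sum]
    refine (enorm_sum_le _ _).trans (Finset.sum_le_sum fun β hβ => ?_)
    rw [← ofReal_norm, ← ofReal_norm, ← ENNReal.ofReal_mul (by unfold remainderConst; positivity)]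
    refine ENNReal.ofReal_le_ofReal ?_
    have e1 : |(1 - t) ^ (n - 1)| ≤ 1 := by
      rw [abs_pow, abs_of_pos (by linarith [ht.2])]
      exact pow_le_one₀ (by linarith [ht.2]) (by linarith [ht.1])
    have e2 := abs_monomial_le β hxz
    rw [mem_multiIndices.1 hβ] at e2
    simp only [norm_mul, Real.norm_eq_abs, remainderConst, abs_div, abs_one, Nat.abs_cast]
    calc (n : ℝ) * |(1 - t) ^ (n - 1)| * (1 / (MultiIndex.fact β : ℝ) *
          |mollify ψ (G β) (z + t • (x - z))| * |monomial β (x - z)|)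
        ≤ n * 1 * (1 / (MultiIndex.fact β : ℝ) *
          |mollify ψ (G β) (z + t • (x - z))| * h ^ n) := by gcongr
      _ = _ := by ring
  refine (setLIntegral_mono' measurableSet_Ioo h2).trans (le_of_eq ?_)
  rw [lintegral_finsetSum' _ fun β hβ => ?_]
  · refine Finset.sum_congr rfl fun β _ => ?_
    rw [lintegral_const_mul' _ _ ENNReal.ofReal_ne_top]
    rfl
  · have h3 : Continuous fun t : ℝ => mollify ψ (G β) (z + t • (x - z)) :=
      (hc β hβ).comp (by fun_prop)
    exact (h3.measurable.enorm.const_mul _).aemeasurable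

/-- A crude bound, with `1/α!` replaced by one, suffices because it is used only for errors that
tend to zero. -/
lemma enorm_taylorSum_sub_le (G G' : MultiIndex N → E N → ℝ) {x z : E N} {h : ℝ}
    (hxz : ‖x - z‖ ≤ h) :
    ‖taylorSum n G z x - taylorSum n G' z x‖ₑ ≤ ∑ k ∈ Finset.range n, ∑ α ∈ multiIndices N k,
      ENNReal.ofReal (h ^ k) * ‖G α z - G' α z‖ₑ := by
  have h0 : 0 ≤ h := (norm_nonneg _).trans hxz
  simp only [taylorSum, ← Finset.sum_sub_distrib]
  refine (enorm_sum_le _ _).trans (Finset.sum_le_sum fun k _ =>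
    (enorm_sum_le _ _).trans (Finset.sum_le_sum fun α hα => ?_))
  rw [← ofReal_norm, ← ofReal_norm, ← ENNReal.ofReal_mul (by positivity)]
  refine ENNReal.ofReal_le_ofReal ?_
  have e2 := abs_monomial_le α hxz
  rw [mem_multiIndices.1 hα] at e2
  have e3 : 1 / (MultiIndex.fact α : ℝ) ≤ 1 := by
    rw [div_le_one (by exact_mod_cast MultiIndex.fact_pos α)]
    exact_mod_cast MultiIndex.fact_pos α
  rw [← sub_mul, ← mul_sub]
  simp only [norm_mul, Real.norm_eq_abs, abs_div, abs_one, Nat.abs_cast]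
  calc 1 / (MultiIndex.fact α : ℝ) * |G α z - G' α z| * |monomial α (x - z)|
      ≤ 1 * |G α z - G' α z| * h ^ k := by gcongr
    _ = _ := by ring

end Jet

/-! ### Removing the mollification -/

section Remainder

variable {Υ : Set (E N)} {n : ℕ} {G : MultiIndex N → E N → ℝ}

lemma segmentIntegral_le_add {f g k : E N → ℝ≥0∞} (hf : Measurable f) (h : ∀ q, k q ≤ f q + g q)
    (p : E N × E N) : segmentIntegral k p ≤ segmentIntegral f p + segmentIntegral g p := by
  unfold segmentIntegral
  have hfm : Measurable fun t : ℝ => f (p.2 + t • (p.1 - p.2)) := hf.comp (by fun_prop)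
  rw [← lintegral_add_left hfm]
  exact lintegral_mono fun t => h _

/-- A segment is compact, so it has a positive distance to the complement of `Υ`. The threshold on
`k` depends on the pair `(x, z)`, which is harmless for a pointwise limit. -/
lemma eventually_closedBall_subset (hΥ : IsOpen Υ) {x z : E N} (hseg : segment ℝ x z ⊆ Υ)
    {r : ℕ → ℝ} (hr : Filter.Tendsto r Filter.atTop (nhds 0)) :
    ∀ᶠ k in Filter.atTop, ∀ t ∈ Set.Icc (0 : ℝ) 1,
      Metric.closedBall (z + t • (x - z)) (r k) ⊆ Υ := by
  have himage : segment ℝ x z = (fun t : ℝ => z + t • (x - z)) '' Set.Icc 0 1 := by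
    rw [segment_symm, segment_eq_image']
  have hcomp : IsCompact (segment ℝ x z) := by
    rw [himage]
    exact isCompact_Icc.image (by fun_prop)
  obtain ⟨δ, hδ, h1⟩ := hcomp.exists_cthickening_subset_open hΥ hseg
  filter_upwards [hr.eventually_lt_const hδ] with k hk
  intro t ht
  have hmem : z + t • (x - z) ∈ segment ℝ x z := by
    rw [himage]
    exact Set.mem_image_of_mem _ ht
  exact (Metric.closedBall_subset_cthickening hmem (r k)).trans
    ((Metric.cthickening_mono hk.le _).trans h1)

/-- **Taylor's estimate** for weak derivatives, at almost every pair of points. -/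
theorem IsWeakJet.ae_enorm_sub_taylorSum_le (hG : IsWeakJet Υ n G) (hn : 1 ≤ n) (hΥ : IsOpen Υ)
    (hb : Bornology.IsBounded Υ) {y : E N} {h ρ : ℝ} (hh : 0 < h) (hρ : 0 < ρ)
    (hρ1 : ρ < 1) (hΥ2 : Υ ⊆ Metric.closedBall y ((1 - ρ) * h))
    (hdiam : ∀ x ∈ Υ, ∀ z ∈ Υ, ‖x - z‖ ≤ h) (hstar : StarShapedWrt Υ (Metric.ball y (ρ * h))) :
    ∀ᵐ p ∂((volume.restrict Υ).prod (volume.restrict (Metric.ball y (ρ * h)))),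
      ‖G 0 p.1 - taylorSum n G p.2 p.1‖ₑ ≤ ∑ β ∈ multiIndices N n,
        ENNReal.ofReal (remainderConst n h β) * segmentIntegral (fun q => ‖G β q‖ₑ) p := by
  set B := Metric.ball y (ρ * h) with hB
  set μ := (volume.restrict Υ).prod (volume.restrict B) with hμ
  have hΥfin : volume Υ ≠ ⊤ := hb.measure_lt_top.ne
  have hBfin : volume B ≠ ⊤ := Metric.isBounded_ball.measure_lt_top.ne
  let ψ : ℕ → ContDiffBump (0 : E N) := fun k =>
    ⟨1 / (2 * ((k : ℝ) + 1)), 1 / ((k : ℝ) + 1), by positivity, by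
      apply one_div_lt_one_div_of_lt (by positivity); linarith [Nat.cast_nonneg (α := ℝ) k]⟩
  have hψ : Filter.Tendsto (fun k => (ψ k).rOut) Filter.atTop (nhds 0) :=
    tendsto_one_div_add_atTop_nhds_zero_nat
  let e : ℕ → MultiIndex N → E N → ℝ≥0∞ := fun k α q => ‖mollify (ψ k) (G α) q - G α q‖ₑ
  have hmm : ∀ k α, MultiIndex.length α ≤ n → Measurable (mollify (ψ k) (G α)) := fun k α hα =>
    (contDiff_mollify (hG.integrable α hα)).continuous.measurable
  have hem : ∀ k α, MultiIndex.length α ≤ n → Measurable (e k α) := fun k α hα =>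
    ((hmm k α hα).sub (hG.measurable α)).enorm
  have he : ∀ α, MultiIndex.length α ≤ n →
      Filter.Tendsto (fun k => ∫⁻ x, e k α x) Filter.atTop (nhds 0) := fun α hα =>
    tendsto_lintegral_mollify_sub hψ (hG.measurable α) (hG.integrable α hα)
  -- `D k` collects all errors made by mollifying: in the value at `x`, in the Taylor coefficients
  -- at `z`, and in the remainder along the segment.
  let D : ℕ → E N × E N → ℝ≥0∞ := fun k p => e k 0 p.1 +
    ∑ j ∈ Finset.range n, ∑ α ∈ multiIndices N j, ENNReal.ofReal (h ^ j) * e k α p.2 +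
    ∑ β ∈ multiIndices N n, ENNReal.ofReal (remainderConst n h β) * segmentIntegral (e k β) p
  have hle : ∀ j ∈ Finset.range n, ∀ α ∈ multiIndices N j, MultiIndex.length α ≤ n :=
    fun j hj α hα => by
      rw [mem_multiIndices.1 hα]; exact (Finset.mem_range.1 hj).le
  have hle' : ∀ β ∈ multiIndices N n, MultiIndex.length β ≤ n := fun β hβ =>
    (mem_multiIndices.1 hβ).le
  have hm1 : ∀ k, Measurable fun p : E N × E N => e k 0 p.1 := fun k =>
    (hem k 0 (by simp)).comp measurable_fst
  have hm2 : ∀ k, ∀ j ∈ Finset.range n, ∀ α ∈ multiIndices N j,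
      Measurable fun p : E N × E N => ENNReal.ofReal (h ^ j) * e k α p.2 := fun k j hj α hα =>
    ((hem k α (hle j hj α hα)).comp measurable_snd).const_mul _
  have hm3 : ∀ k, ∀ β ∈ multiIndices N n, Measurable fun p : E N × E N =>
      ENNReal.ofReal (remainderConst n h β) * segmentIntegral (e k β) p := fun k β hβ =>
    (measurable_segmentIntegral (hem k β (hle' β hβ))).const_mul _
  have hm2' : ∀ k, Measurable fun p : E N × E N =>
      ∑ j ∈ Finset.range n, ∑ α ∈ multiIndices N j, ENNReal.ofReal (h ^ j) * e k α p.2 := fun k =>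
    Finset.measurable_fun_sum _ fun j hj => Finset.measurable_fun_sum _ fun α hα => hm2 k j hj α hα
  have hDm : ∀ k, Measurable (D k) := fun k =>
    ((hm1 k).add (hm2' k)).add (Finset.measurable_fun_sum _ (hm3 k))
  have hfst : ∀ f : E N → ℝ≥0∞, Measurable f →
      ∫⁻ p, f p.1 ∂μ ≤ volume B * ∫⁻ x, f x := by
    intro f hf
    have hf' : Measurable fun p : E N × E N => f p.1 := hf.comp measurable_fst
    rw [lintegral_prod _ hf'.aemeasurable]
    simp only [lintegral_const, Measure.restrict_apply_univ]
    rw [lintegral_mul_const _ hf, mul_comm]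
    gcongr
    exact Measure.restrict_le_self
  have hsnd : ∀ f : E N → ℝ≥0∞, Measurable f →
      ∫⁻ p, f p.2 ∂μ ≤ volume Υ * ∫⁻ x, f x := by
    intro f hf
    have hf' : Measurable fun p : E N × E N => f p.2 := hf.comp measurable_snd
    rw [lintegral_prod _ hf'.aemeasurable]
    simp only [lintegral_const, Measure.restrict_apply_univ]
    rw [mul_comm]
    gcongr
    exact Measure.restrict_le_self
  set C := volume B * ENNReal.ofReal ((ρ ^ N)⁻¹) with hC
  have hCfin : C ≠ ⊤ := ENNReal.mul_ne_top hBfin ENNReal.ofReal_ne_top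
  have hDlim : Filter.Tendsto (fun k => ∫⁻ p, D k p ∂μ) Filter.atTop (nhds 0) := by
    have hbound : ∀ k, ∫⁻ p, D k p ∂μ ≤ volume B * (∫⁻ x, e k 0 x) +
        ∑ j ∈ Finset.range n, ∑ α ∈ multiIndices N j,
          ENNReal.ofReal (h ^ j) * (volume Υ * ∫⁻ x, e k α x) +
        ∑ β ∈ multiIndices N n,
          ENNReal.ofReal (remainderConst n h β) * (C * ∫⁻ x, e k β x) := by
      intro k
      simp only [D]
      have hm12 : Measurable fun p : E N × E N => e k 0 p.1 + ∑ j ∈ Finset.range n,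
          ∑ α ∈ multiIndices N j, ENNReal.ofReal (h ^ j) * e k α p.2 := (hm1 k).add (hm2' k)
      rw [lintegral_add_left hm12, lintegral_add_left (hm1 k),
        lintegral_finsetSum' _ fun j hj =>
          (Finset.measurable_fun_sum _ fun α hα => hm2 k j hj α hα).aemeasurable,
        lintegral_finsetSum' _ fun β hβ => (hm3 k β hβ).aemeasurable]
      refine add_le_add (add_le_add (hfst _ (hem k 0 (by simp))) ?_) ?_
      · refine Finset.sum_le_sum fun j hj => ?_
        rw [lintegral_finsetSum' _ fun α hα => (hm2 k j hj α hα).aemeasurable]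
        refine Finset.sum_le_sum fun α hα => ?_
        rw [lintegral_const_mul' _ _ ENNReal.ofReal_ne_top]
        gcongr
        exact hsnd _ (hem k α (hle j hj α hα))
      · refine Finset.sum_le_sum fun β hβ => ?_
        rw [lintegral_const_mul' _ _ ENNReal.ofReal_ne_top]
        gcongr
        exact lintegral_segmentIntegral_le hh hρ hρ1 hΥ2 (hem k β (hle' β hβ))
    refine tendsto_of_tendsto_of_tendsto_of_le_of_le tendsto_const_nhds ?_ (fun _ => bot_le)
      hbound
    have hmul : ∀ (c : ℝ≥0∞) (f : ℕ → ℝ≥0∞), c ≠ ⊤ → Filter.Tendsto f Filter.atTop (nhds 0) →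
        Filter.Tendsto (fun k => c * f k) Filter.atTop (nhds 0) := by
      intro c f hc hf
      simpa using ENNReal.Tendsto.const_mul hf (Or.inr hc)
    have t1 := hmul _ _ hBfin (he 0 (by simp))
    have t2 : Filter.Tendsto (fun k => ∑ j ∈ Finset.range n, ∑ α ∈ multiIndices N j,
        ENNReal.ofReal (h ^ j) * (volume Υ * ∫⁻ x, e k α x)) Filter.atTop (nhds 0) := by
      have := tendsto_finsetSum (Finset.range n) fun j hj =>
        tendsto_finsetSum (multiIndices N j) fun α hα =>
          hmul (ENNReal.ofReal (h ^ j)) _ ENNReal.ofReal_ne_top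
            (hmul _ _ hΥfin (he α (hle j hj α hα)))
      simpa using this
    have t3 : Filter.Tendsto (fun k => ∑ β ∈ multiIndices N n,
        ENNReal.ofReal (remainderConst n h β) * (C * ∫⁻ x, e k β x)) Filter.atTop (nhds 0) := by
      have := tendsto_finsetSum (multiIndices N n) fun β hβ =>
          hmul (ENNReal.ofReal (remainderConst n h β)) _ ENNReal.ofReal_ne_top
            (hmul _ _ hCfin (he β (hle' β hβ)))
      simpa using this
    simpa using (t1.add t2).add t3
  -- Fatou's lemma replaces the extraction of an almost everywhere convergent subsequence.
  have hlim : ∀ᵐ p ∂μ, Filter.liminf (fun k => D k p) Filter.atTop = 0 := by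
    have h1 := lintegral_liminf_le (μ := μ) (u := Filter.atTop) hDm
    have hlm : Measurable fun p => Filter.liminf (fun k => D k p) Filter.atTop :=
      Measurable.liminf hDm
    rw [hDlim.liminf_eq, nonpos_iff_eq_zero, lintegral_eq_zero_iff hlm] at h1
    exact h1
  have hmem : ∀ᵐ p ∂μ, p ∈ Υ ×ˢ B := by
    rw [hμ, Measure.prod_restrict]
    exact ae_restrict_mem (hΥ.measurableSet.prod measurableSet_ball)
  filter_upwards [hlim, hmem] with p hp0 hpm
  obtain ⟨x, z⟩ := p
  obtain ⟨hx, hz⟩ : x ∈ Υ ∧ z ∈ B := hpm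
  have hxz := hdiam x hx z (hstar.1 hz)
  -- The truncated difference of the two sides is independent of `k`; once bounded by `D k p` for
  -- all large `k`, it is at most the lower limit, which is zero.
  rw [← tsub_eq_zero_iff_le, ← nonpos_iff_eq_zero, ← hp0]
  refine Filter.le_liminf_of_le (by isBoundedDefault) ?_
  filter_upwards [eventually_closedBall_subset hΥ (hstar.2 x hx z hz) hψ] with k hk
  rw [tsub_le_iff_right]
  have b1 := hG.enorm_mollify_sub_le hn hxz hk
  have b2 := enorm_taylorSum_sub_le (n := n) (fun α => mollify (ψ k) (G α)) G hxz
  have b3 : ∑ β ∈ multiIndices N n, ENNReal.ofReal (remainderConst n h β) *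
      segmentIntegral (fun q => ‖mollify (ψ k) (G β) q‖ₑ) (x, z) ≤
      ∑ β ∈ multiIndices N n, ENNReal.ofReal (remainderConst n h β) *
        segmentIntegral (e k β) (x, z) + ∑ β ∈ multiIndices N n,
        ENNReal.ofReal (remainderConst n h β) * segmentIntegral (fun q => ‖G β q‖ₑ) (x, z) := by
    rw [← Finset.sum_add_distrib]
    refine Finset.sum_le_sum fun β hβ => ?_
    rw [← mul_add]
    gcongr
    refine segmentIntegral_le_add (hem k β (hle' β hβ)) (fun q => ?_) _
    calc ‖mollify (ψ k) (G β) q‖ₑ = ‖(mollify (ψ k) (G β) q - G β q) + G β q‖ₑ := by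
          rw [sub_add_cancel]
      _ ≤ _ := enorm_add_le _ _
  have b4 : ‖G 0 x - taylorSum n G z x‖ₑ ≤ e k 0 x +
      ‖mollify (ψ k) (G 0) x - taylorSum n (fun α => mollify (ψ k) (G α)) z x‖ₑ +
      ‖taylorSum n (fun α => mollify (ψ k) (G α)) z x - taylorSum n G z x‖ₑ := by
    have e0 : e k 0 x = ‖G 0 x - mollify (ψ k) (G 0) x‖ₑ := enorm_sub_rev _ _
    rw [e0]
    refine le_trans (le_of_eq ?_) ((enorm_add_le _ _).trans
      (add_le_add_left (enorm_add_le _ _) _))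
    congr 1
    ring
  calc ‖G 0 x - taylorSum n G z x‖ₑ ≤ _ := b4
    _ ≤ e k 0 x + (∑ β ∈ multiIndices N n, ENNReal.ofReal (remainderConst n h β) *
        segmentIntegral (e k β) (x, z) + ∑ β ∈ multiIndices N n,
        ENNReal.ofReal (remainderConst n h β) * segmentIntegral (fun q => ‖G β q‖ₑ) (x, z)) +
        ∑ j ∈ Finset.range n, ∑ α ∈ multiIndices N j, ENNReal.ofReal (h ^ j) * e k α z :=
        add_le_add (add_le_add le_rfl (b1.trans b3)) b2
    _ = _ := by
        simp only [D]
        ring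

end Remainder

/-! ### Constants and Cauchy–Schwarz inequalities -/

lemma card_multiIndices (hN : 1 ≤ N) (j : ℕ) :
    (multiIndices N j).card = (N + j - 1).choose (N - 1) := by
  let _ : Fintype {P : Fin N → ℕ // ∑ i, P i = j} :=
    Fintype.subtype (multiIndices N j) fun P => mem_multiIndices
  have h1 : Fintype.card {P : Fin N → ℕ // ∑ i, P i = j} = (multiIndices N j).card :=
    Fintype.card_of_subtype (p := fun P : Fin N → ℕ => ∑ i, P i = j) (multiIndices N j)
      fun P => mem_multiIndices
  rw [← h1, ← Fintype.card_congr (Sym.equivNatSumOfFintype (Fin N) j), Sym.card_sym_eq_choose,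
    Fintype.card_fin]
  exact Nat.choose_symm_of_eq_add (by omega)

/-- This is the multinomial theorem for `(1 + ⋯ + 1)^n`, divided by `n!`. -/
lemma sum_one_div_fact (n : ℕ) :
    ∑ β ∈ multiIndices N n, 1 / (MultiIndex.fact β : ℝ) = (N : ℝ) ^ n / n ! := by
  have h1 := Finset.sum_pow_eq_sum_piAntidiag (Finset.univ : Finset (Fin N)) (fun _ => (1 : ℝ)) n
  simp only [Finset.sum_const, Finset.card_univ, Fintype.card_fin, nsmul_eq_mul, mul_one,
    one_pow, Finset.prod_const_one] at h1
  rw [h1, Finset.sum_div]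
  refine Finset.sum_congr rfl fun β hβ => ?_
  have h2 := Nat.multinomial_spec (Finset.univ : Finset (Fin N)) β
  have h3 : ∑ i, β i = n := mem_multiIndices.1 hβ
  rw [h3] at h2
  have h4 : (MultiIndex.fact β : ℝ) * Nat.multinomial Finset.univ β = n ! := by
    exact_mod_cast h2
  have h5 : (MultiIndex.fact β : ℝ) ≠ 0 := by exact_mod_cast (MultiIndex.fact_pos β).ne'
  have h6 : ((n ! : ℕ) : ℝ) ≠ 0 := by exact_mod_cast n.factorial_ne_zero
  rw [div_eq_div_iff h5 h6]
  linarith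

lemma sum_remainderConst {n : ℕ} (hn : 1 ≤ n) (h : ℝ) :
    ∑ β ∈ multiIndices N n, remainderConst n h β = (N : ℝ) ^ n / (n - 1)! * h ^ n := by
  unfold remainderConst
  rw [← Finset.sum_mul, ← Finset.mul_sum, sum_one_div_fact]
  obtain ⟨k, rfl⟩ : ∃ k, n = k + 1 := ⟨n - 1, by omega⟩
  rw [Nat.add_sub_cancel, Nat.factorial_succ]
  have : ((k ! : ℕ) : ℝ) ≠ 0 := by exact_mod_cast k.factorial_ne_zero
  have h2 : ((k : ℝ) + 1) ≠ 0 := by positivity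
  push_cast
  field_simp

lemma sq_lintegral_le {X : Type*} [MeasurableSpace X] (μ : Measure X) [IsProbabilityMeasure μ]
    {f : X → ℝ≥0∞} (hf : AEMeasurable f μ) : (∫⁻ x, f x ∂μ) ^ 2 ≤ ∫⁻ x, f x ^ 2 ∂μ := by
  have h1 := ENNReal.lintegral_mul_le_Lp_mul_Lq μ Real.HolderConjugate.two_two hf
    (aemeasurable_const (b := (1 : ℝ≥0∞)))
  simp only [Pi.mul_apply, mul_one, ENNReal.one_rpow, lintegral_const, measure_univ] at h1
  calc (∫⁻ x, f x ∂μ) ^ 2 ≤ ((∫⁻ x, f x ^ (2 : ℝ) ∂μ) ^ (1 / 2 : ℝ)) ^ 2 := by gcongr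
    _ = ∫⁻ x, f x ^ 2 ∂μ := by
      rw [← ENNReal.rpow_natCast, ← ENNReal.rpow_mul]
      norm_num

lemma sq_sum_mul_le {ι : Type*} (s : Finset ι) (w f : ι → ℝ≥0∞) :
    (∑ i ∈ s, w i * f i) ^ 2 ≤ (∑ i ∈ s, w i) * ∑ i ∈ s, w i * f i ^ 2 := by
  have h1 := ENNReal.inner_le_weight_mul_Lp_of_nonneg s (p := 2) (by norm_num) w f
  calc (∑ i ∈ s, w i * f i) ^ 2
      ≤ ((∑ i ∈ s, w i) ^ (1 - (2 : ℝ)⁻¹) * (∑ i ∈ s, w i * f i ^ (2 : ℝ)) ^ (2 : ℝ)⁻¹) ^ 2 := by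
        gcongr
    _ = (∑ i ∈ s, w i) * ∑ i ∈ s, w i * f i ^ 2 := by
      rw [mul_pow, ← ENNReal.rpow_natCast, ← ENNReal.rpow_natCast, ← ENNReal.rpow_mul,
        ← ENNReal.rpow_mul]
      norm_num

lemma sq_segmentIntegral_le {f : E N → ℝ≥0∞} (hf : Measurable f) (p : E N × E N) :
    segmentIntegral f p ^ 2 ≤ segmentIntegral (fun q => f q ^ 2) p := by
  have : IsProbabilityMeasure (volume.restrict (Set.Ioo (0 : ℝ) 1)) := ⟨by simp⟩
  have hfm : Measurable fun t : ℝ => f (p.2 + t • (p.1 - p.2)) := hf.comp (by fun_prop)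
  exact sq_lintegral_le _ hfm.aemeasurable

/-! ### The `L²` estimate for the averaged Taylor polynomial -/

section Estimate

variable {Υ : Set (E N)} {n : ℕ} {G : MultiIndex N → E N → ℝ}

/-- The error is the average over `z ∈ B` of `u(x) - T_z u(x)`. Cauchy–Schwarz is applied three
times: to the sum over `β` with the remainder constants as weights, to the average in `z`, and to
the integral along the segment. What remains is the segment integral of `|D^β u|²` over `Υ × B`. -/
theorem IsWeakJet.lintegral_sq_sub_averagedTaylorSum_le (hG : IsWeakJet Υ n G) (hn : 1 ≤ n)
    (hΥ : IsOpen Υ) (hb : Bornology.IsBounded Υ) {y : E N} {h ρ : ℝ} (hh : 0 < h) (hρ : 0 < ρ)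
    (hρ1 : ρ < 1) (hΥ2 : Υ ⊆ Metric.closedBall y ((1 - ρ) * h))
    (hdiam : ∀ x ∈ Υ, ∀ z ∈ Υ, ‖x - z‖ ≤ h) (hstar : StarShapedWrt Υ (Metric.ball y (ρ * h))) :
    ∫⁻ x in Υ, ‖G 0 x - averagedTaylorSum (Metric.ball y (ρ * h)) n G x‖ₑ ^ 2
      ≤ ENNReal.ofReal (((N : ℝ) ^ n / (n - 1)! * h ^ n) ^ 2 * (ρ ^ N)⁻¹) *
        ∑ β ∈ multiIndices N n, ∫⁻ x, ‖G β x‖ₑ ^ 2 := by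
  have hae := Measure.ae_ae_of_ae_prod
    (hG.ae_enorm_sub_taylorSum_le hn hΥ hb hh hρ hρ1 hΥ2 hdiam hstar)
  set B := Metric.ball y (ρ * h) with hB
  have hBpos : volume B ≠ 0 := (Metric.measure_ball_pos volume y (by positivity)).ne'
  have hBfin : volume B ≠ ⊤ := Metric.isBounded_ball.measure_lt_top.ne
  have : IsFiniteMeasure (volume.restrict B) := ⟨by
    rw [Measure.restrict_apply_univ]; exact hBfin.lt_top⟩
  set ν : Measure (E N) := (volume B)⁻¹ • volume.restrict B with hν
  have hνp : IsProbabilityMeasure ν := ⟨by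
    rw [hν, Measure.smul_apply, Measure.restrict_apply_univ, smul_eq_mul]
    exact ENNReal.inv_mul_cancel hBpos hBfin⟩
  set c : MultiIndex N → ℝ≥0∞ := fun β => ENNReal.ofReal (remainderConst n h β) with hc
  set W : MultiIndex N → E N → ℝ≥0∞ := fun β x =>
    ∫⁻ z, segmentIntegral (fun q => ‖G β q‖ₑ) (x, z) ∂ν with hW
  have hmeas : ∀ β, Measurable (segmentIntegral fun q => ‖G β q‖ₑ) := fun β =>
    measurable_segmentIntegral (hG.measurable β).enorm
  have hmeas2 : ∀ β, Measurable (segmentIntegral fun q => ‖G β q‖ₑ ^ 2) := fun β =>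
    measurable_segmentIntegral ((hG.measurable β).enorm.pow_const 2)
  have hint : ∀ α, MultiIndex.length α < n → IntegrableOn (G α) B := fun α hα =>
    (hG.integrable α hα.le).integrableOn
  have hcsum : ∑ β ∈ multiIndices N n, c β = ENNReal.ofReal ((N : ℝ) ^ n / (n - 1)! * h ^ n) := by
    rw [← sum_remainderConst hn, ENNReal.ofReal_sum_of_nonneg]
    intro β _
    unfold remainderConst
    positivity
  have hpt : ∀ᵐ x ∂volume.restrict Υ, ‖G 0 x - averagedTaylorSum B n G x‖ₑ
      ≤ ∑ β ∈ multiIndices N n, c β * W β x := by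
    filter_upwards [hae] with x hx
    have hi := integrableOn_taylorSum measurableSet_ball Metric.isBounded_ball hint x
    have e1 : G 0 x - averagedTaylorSum B n G x = ∫ z, (G 0 x - taylorSum n G z x) ∂ν := by
      rw [hν, integral_smul_measure, integral_sub (integrable_const _) hi, integral_const,
        ENNReal.toReal_inv, averagedTaylorSum]
      have : volume.real B ≠ 0 := (ENNReal.toReal_pos hBpos hBfin).ne'
      simp only [measureReal_restrict_apply_univ, smul_eq_mul]
      rw [mul_sub, ← mul_assoc]
      change _ = (volume.real B)⁻¹ * volume.real B * _ - (volume.real B)⁻¹ * _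
      rw [inv_mul_cancel₀ this, one_mul]
    rw [e1]
    refine (enorm_integral_le_lintegral_enorm _).trans ?_
    have e2 : ∀ᵐ z ∂ν, ‖G 0 x - taylorSum n G z x‖ₑ ≤ ∑ β ∈ multiIndices N n,
        c β * segmentIntegral (fun q => ‖G β q‖ₑ) (x, z) := Measure.ae_smul_measure hx _
    refine (lintegral_mono_ae e2).trans (le_of_eq ?_)
    have e3 : ∀ β, Measurable fun z => c β * segmentIntegral (fun q => ‖G β q‖ₑ) (x, z) := fun β =>
      ((hmeas β).comp measurable_prodMk_left).const_mul _
    rw [lintegral_finsetSum' _ fun β _ => (e3 β).aemeasurable]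
    refine Finset.sum_congr rfl fun β _ => ?_
    rw [lintegral_const_mul' _ _ ENNReal.ofReal_ne_top]
  have hWm : ∀ β, Measurable (W β) := fun β => (hmeas β).lintegral_prod_right'
  have hWsq : ∀ β, ∫⁻ x in Υ, W β x ^ 2 ≤ ENNReal.ofReal ((ρ ^ N)⁻¹) * ∫⁻ x, ‖G β x‖ₑ ^ 2 := by
    intro β
    calc ∫⁻ x in Υ, W β x ^ 2
        ≤ ∫⁻ x in Υ, ∫⁻ z, segmentIntegral (fun q => ‖G β q‖ₑ ^ 2) (x, z) ∂ν := by
          refine lintegral_mono fun x => ?_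
          refine (sq_lintegral_le ν ((hmeas β).comp measurable_prodMk_left).aemeasurable).trans ?_
          exact lintegral_mono fun z => sq_segmentIntegral_le (hG.measurable β).enorm _
      _ = (volume B)⁻¹ * ∫⁻ p, segmentIntegral (fun q => ‖G β q‖ₑ ^ 2) p
            ∂((volume.restrict Υ).prod (volume.restrict B)) := by
          simp only [hν, lintegral_smul_measure, smul_eq_mul]
          rw [lintegral_const_mul' _ _ (ENNReal.inv_ne_top.2 hBpos),
            lintegral_prod _ (hmeas2 β).aemeasurable]
      _ ≤ (volume B)⁻¹ * (volume B * ENNReal.ofReal ((ρ ^ N)⁻¹) * ∫⁻ x, ‖G β x‖ₑ ^ 2) := by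
          gcongr
          exact lintegral_segmentIntegral_le hh hρ hρ1 hΥ2 ((hG.measurable β).enorm.pow_const 2)
      _ = _ := by
          rw [← mul_assoc, ← mul_assoc, ENNReal.inv_mul_cancel hBpos hBfin, one_mul]
  set K := ENNReal.ofReal ((N : ℝ) ^ n / (n - 1)! * h ^ n) with hK
  calc ∫⁻ x in Υ, ‖G 0 x - averagedTaylorSum B n G x‖ₑ ^ 2
      ≤ ∫⁻ x in Υ, K * ∑ β ∈ multiIndices N n, c β * W β x ^ 2 := by
        refine lintegral_mono_ae ?_
        filter_upwards [hpt] with x hx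
        rw [← hcsum]
        exact (pow_le_pow_left₀ bot_le hx 2).trans (sq_sum_mul_le _ _ _)
    _ = K * ∑ β ∈ multiIndices N n, c β * ∫⁻ x in Υ, W β x ^ 2 := by
        rw [lintegral_const_mul' _ _ ENNReal.ofReal_ne_top, lintegral_finsetSum' _ fun β _ =>
          (((hWm β).pow_const 2).const_mul _).aemeasurable]
        congr 1
        refine Finset.sum_congr rfl fun β _ => ?_
        rw [lintegral_const_mul' _ _ ENNReal.ofReal_ne_top]
    _ ≤ K * ∑ β ∈ multiIndices N n, K * (ENNReal.ofReal ((ρ ^ N)⁻¹) * ∫⁻ x, ‖G β x‖ₑ ^ 2) := by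
        -- Each single weight is bounded by the sum `K` of all weights, whence the square of `K` in
        -- the constant.
        gcongr with β hβ
        · rw [← hcsum]
          exact Finset.single_le_sum (f := c) (fun _ _ => bot_le) hβ
        · exact hWsq β
    _ = _ := by
        rw [← Finset.mul_sum, ← Finset.mul_sum, ENNReal.ofReal_mul (by positivity),
          ENNReal.ofReal_pow (by positivity), ← hK, sq]
        ring

end Estimate

lemma ofReal_integral_sq {X : Type*} [MeasurableSpace X] {μ : Measure X} {f : X → ℝ}
    (hf : MemLp f 2 μ) : ENNReal.ofReal (∫ x, f x ^ 2 ∂μ) = ∫⁻ x, ‖f x‖ₑ ^ 2 ∂μ := by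
  rw [ofReal_integral_eq_lintegral_ofReal hf.integrable_sq
    (Filter.Eventually.of_forall fun x => sq_nonneg _)]
  refine lintegral_congr fun x => ?_
  rw [Real.enorm_eq_ofReal_abs, ← ENNReal.ofReal_pow (abs_nonneg _), sq_abs]

section Estimate

variable {Υ : Set (E N)} {n : ℕ} {f : MultiIndex N → E N → ℝ}

/-- A family of weak derivatives on `Υ` has measurable representatives vanishing outside `Υ`. -/
lemma exists_isWeakJet (hΥ : IsOpen Υ) (hb : Bornology.IsBounded Υ)
    (hf : ∀ α, MultiIndex.length α ≤ n → MemLp (f α) 2 (volume.restrict Υ))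
    (hf' : ∀ α, MultiIndex.length α < n → ∀ i η, IsTestFunction Υ η →
      ∫ x in Υ, f α x * partialDeriv i η x = -∫ x in Υ, f (α + Pi.single i 1) x * η x) :
    ∃ G, IsWeakJet Υ n G ∧ ∀ α, MultiIndex.length α ≤ n →
      G α =ᵐ[volume.restrict Υ] f α ∧ ∀ x ∉ Υ, G α x = 0 := by
  have h1 : ∀ α, ∃ g : E N → ℝ, Measurable g ∧ (MultiIndex.length α ≤ n →
      g =ᵐ[volume.restrict Υ] f α ∧ ∀ x ∉ Υ, g x = 0) := by
    intro α
    by_cases hα : MultiIndex.length α ≤ n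
    · obtain ⟨g, hg, hgf⟩ := (hf α hα).1.aemeasurable
      -- Extension by zero makes `g` integrable on the whole space, as convolution requires. It need
      -- not respect weak derivatives across the boundary; the jet condition tests only inside `Υ`.
      refine ⟨Υ.indicator g, hg.indicator hΥ.measurableSet, fun _ => ⟨?_, fun x hx => ?_⟩⟩
      · exact (indicator_ae_eq_restrict hΥ.measurableSet).trans hgf.symm
      · exact Set.indicator_of_notMem hx _
    · exact ⟨0, measurable_const, fun h => absurd h hα⟩
  choose G hGm hG using h1
  refine ⟨G, ⟨hGm, fun α hα => ?_, fun α hα i η hη => ?_⟩, hG⟩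
  · refine (integrableOn_iff_integrable_of_support_subset (s := Υ) fun x hx => ?_).1 ?_
    · by_contra h
      exact hx ((hG α hα).2 x h)
    · exact integrableOn_of_memLp_two hb le_rfl ((hf α hα).ae_eq (hG α hα).1.symm)
  · have hα' : MultiIndex.length (α + Pi.single i 1) ≤ n := by
      rw [MultiIndex.length_add, MultiIndex.length_single]
      omega
    rw [← (hη.partialDeriv i).setIntegral, ← hη.setIntegral]
    have e1 : ∫ x in Υ, G α x * partialDeriv i η x = ∫ x in Υ, f α x * partialDeriv i η x := by
      refine integral_congr_ae ?_
      filter_upwards [(hG α hα.le).1] with x hx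
      rw [hx]
    have e2 : ∫ x in Υ, G (α + Pi.single i 1) x * η x
        = ∫ x in Υ, f (α + Pi.single i 1) x * η x := by
      refine integral_congr_ae ?_
      filter_upwards [(hG _ hα').1] with x hx
      rw [hx]
    rw [e1, e2, hf' α hα i η hη]

lemma averagedTaylorSum_congr_ae {B : Set (E N)} {G G' : MultiIndex N → E N → ℝ}
    (h : ∀ α, MultiIndex.length α < n → G α =ᵐ[volume.restrict B] G' α) :
    averagedTaylorSum B n G = averagedTaylorSum B n G' := by
  funext x
  unfold averagedTaylorSum
  congr 1
  refine integral_congr_ae ?_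
  have hae : ∀ᵐ z ∂volume.restrict B, ∀ k ∈ Finset.range n, ∀ α ∈ multiIndices N k,
      G α z = G' α z := by
    rw [Finset.eventually_all]
    intro k hk
    rw [Finset.eventually_all]
    intro α hα
    refine h α ?_
    rw [mem_multiIndices.1 hα]
    exact Finset.mem_range.1 hk
  filter_upwards [hae] with z hz
  unfold taylorSum
  exact Finset.sum_congr rfl fun k hk => Finset.sum_congr rfl fun α hα => by rw [hz k hk α hα]

theorem integral_sq_sub_averagedTaylorSum_le (hn : 1 ≤ n) (hΥ : IsOpen Υ)
    (hb : Bornology.IsBounded Υ)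
    (hf : ∀ α, MultiIndex.length α ≤ n → MemLp (f α) 2 (volume.restrict Υ))
    (hf' : ∀ α, MultiIndex.length α < n → ∀ i η, IsTestFunction Υ η →
      ∫ x in Υ, f α x * partialDeriv i η x = -∫ x in Υ, f (α + Pi.single i 1) x * η x)
    {y : E N} {ρ : ℝ} (hd : 0 < Metric.diam Υ) (hρ : 0 < ρ) (hρ1 : ρ < 1)
    (hstar : StarShapedWrt Υ (Metric.ball y (ρ * Metric.diam Υ))) :
    ∫ x in Υ, (f 0 x - averagedTaylorSum (Metric.ball y (ρ * Metric.diam Υ)) n f x) ^ 2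
      ≤ ((N : ℝ) ^ n / (n - 1)! * Metric.diam Υ ^ n) ^ 2 * (ρ ^ N)⁻¹ *
        ∑ β ∈ multiIndices N n, ∫ x in Υ, f β x ^ 2 := by
  obtain ⟨G, hG, hGf⟩ := exists_isWeakJet hΥ hb hf hf'
  set B := Metric.ball y (ρ * Metric.diam Υ) with hB
  have h1 := hG.lintegral_sq_sub_averagedTaylorSum_le hn hΥ hb hd hρ hρ1
    (subset_closedBall_of_ball_subset hb hρ hρ1 hstar.1 hd)
    (fun x hx z hz => by rw [← dist_eq_norm]; exact Metric.dist_le_diam_of_mem hb hx hz) hstar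
  rw [← hB] at h1
  have hBint : ∀ α, MultiIndex.length α < n → IntegrableOn (f α) B := fun α hα =>
    integrableOn_of_memLp_two hb hstar.1 (hf α hα.le)
  have hQ : averagedTaylorSum B n G = averagedTaylorSum B n f :=
    averagedTaylorSum_congr_ae fun α hα =>
      ae_mono (Measure.restrict_mono hstar.1 le_rfl) (hGf α hα.le).1
  have hmem : MemLp (fun x => f 0 x - averagedTaylorSum B n f x) 2 (volume.restrict Υ) :=
    (hf 0 (by simp)).sub (memLp_of_continuous_of_isBounded hΥ.measurableSet hb
      (contDiff_averagedTaylorSum measurableSet_ball Metric.isBounded_ball hBint).continuous)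
  have h2 : ∫⁻ x in Υ, ‖G 0 x - averagedTaylorSum B n G x‖ₑ ^ 2
      = ENNReal.ofReal (∫ x in Υ, (f 0 x - averagedTaylorSum B n f x) ^ 2) := by
    rw [ofReal_integral_sq hmem, hQ]
    refine lintegral_congr_ae ?_
    filter_upwards [(hGf 0 (by simp)).1] with x hx
    rw [hx]
  have h3 : ∀ β ∈ multiIndices N n, ∫⁻ x, ‖G β x‖ₑ ^ 2
      = ENNReal.ofReal (∫ x in Υ, f β x ^ 2) := by
    intro β hβ
    have hle := (mem_multiIndices.1 hβ).le
    rw [ofReal_integral_sq (hf β hle), ← setLIntegral_eq_of_support_subset (s := Υ)]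
    · refine lintegral_congr_ae ?_
      filter_upwards [(hGf β hle).1] with x hx
      rw [hx]
    · intro x hx
      by_contra h
      exact hx (by simp [(hGf β hle).2 x h])
  rw [h2, Finset.sum_congr rfl h3, ← ENNReal.ofReal_sum_of_nonneg
    fun β _ => integral_nonneg fun x => sq_nonneg _, ← ENNReal.ofReal_mul (by positivity)] at h1
  refine (ENNReal.ofReal_le_ofReal_iff ?_).1 h1
  exact mul_nonneg (by positivity)
    (Finset.sum_nonneg fun β _ => integral_nonneg fun x => sq_nonneg _)

end Estimate

/-! ### From single derivatives to seminorms -/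

section Seminorm

variable {N' : ℕ} {Υ : Set (E N)} {u : Fin N' → E N → ℝ} {m : ℕ}

lemma diam_pos_of_isOpen (hN : 1 ≤ N) (hΥ : IsOpen Υ) (hb : Bornology.IsBounded Υ) {y : E N}
    (hy : y ∈ Υ) : 0 < Metric.diam Υ := by
  obtain ⟨r, hr, hrΥ⟩ := Metric.isOpen_iff.1 hΥ y hy
  let v : E N := EuclideanSpace.single (⟨0, hN⟩ : Fin N) (r / 2)
  have hv : ‖v‖ = r / 2 := by
    simp [v, abs_of_pos hr]
  have h1 : y + v ∈ Υ := hrΥ (by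
    rw [Metric.mem_ball, dist_eq_norm, add_sub_cancel_left, hv]
    linarith)
  have h2 := Metric.dist_le_diam_of_mem hb h1 hy
  rw [dist_eq_norm, add_sub_cancel_left, hv] at h2
  linarith

variable {B : Set (E N)}

lemma MemH.integrableOn_weakDeriv (hΥ : IsOpen Υ) (hb : Bornology.IsBounded Υ) (hu : MemH Υ m u)
    (hBΥ : B ⊆ Υ) (i : Fin N') {α : MultiIndex N} (hα : MultiIndex.length α ≤ m) :
    IntegrableOn (weakDeriv Υ α (u i)) B :=
  integrableOn_of_memLp_two hb hBΥ (hu.memLp_weakDeriv hΥ hα i)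

/-- Since `D^α` commutes with averaging up to lowering the order, the derivative of the error is the
error of the averaged Taylor polynomial of `D^α u`, of order `m - |α|`. -/
lemma MemH.hasWeakDeriv_sub_averagedTaylor (hΥ : IsOpen Υ) (hb : Bornology.IsBounded Υ)
    (hu : MemH Υ m u) (hB : MeasurableSet B) (hBΥ : B ⊆ Υ) (i : Fin N') {α : MultiIndex N}
    (hα : MultiIndex.length α ≤ m) :
    HasWeakDeriv Υ α ((u - averagedTaylor Υ B m u) i) (weakDeriv Υ α (u i) -
      averagedTaylorSum B (m - MultiIndex.length α) fun β => weakDeriv Υ (β + α) (u i)) := by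
  have hint : ∀ α, MultiIndex.length α < m → IntegrableOn (weakDeriv Υ α (u i)) B :=
    fun α hα => hu.integrableOn_weakDeriv hΥ hb hBΥ i hα.le
  have hbB := hb.subset hBΥ
  have h := hasWeakDeriv_sub_contDiff hΥ (contDiff_averagedTaylorSum hB hbB hint)
    (hu.hasWeakDeriv hα i)
  rw [classicalDeriv_averagedTaylorSum hB hbB hint] at h
  exact h

lemma MemH.memLp_sub_averagedTaylorSum (hΥ : IsOpen Υ) (hb : Bornology.IsBounded Υ)
    (hu : MemH Υ m u) (hB : MeasurableSet B) (hBΥ : B ⊆ Υ) (i : Fin N') {α : MultiIndex N}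
    (hα : MultiIndex.length α ≤ m) :
    MemLp (weakDeriv Υ α (u i) - averagedTaylorSum B (m - MultiIndex.length α)
      fun β => weakDeriv Υ (β + α) (u i)) 2 (volume.restrict Υ) := by
  refine (hu.memLp_weakDeriv hΥ hα i).sub
    (memLp_of_continuous_of_isBounded hΥ.measurableSet hb (contDiff_averagedTaylorSum hB
      (hb.subset hBΥ) fun β hβ => hu.integrableOn_weakDeriv hΥ hb hBΥ i ?_).continuous)
  rw [MultiIndex.length_add]
  omega

lemma MemH.sub_averagedTaylor (hΥ : IsOpen Υ) (hb : Bornology.IsBounded Υ) (hu : MemH Υ m u)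
    (hB : MeasurableSet B) (hBΥ : B ⊆ Υ) : MemH Υ m (u - averagedTaylor Υ B m u) := by
  refine ⟨fun i => ?_, fun i α hα => ⟨_, hu.hasWeakDeriv_sub_averagedTaylor hΥ hb hB hBΥ i hα,
    hu.memLp_sub_averagedTaylorSum hΥ hb hB hBΥ i hα⟩⟩
  exact (hu.1 i).sub (memLp_of_continuous_of_isBounded hΥ.measurableSet hb
    (contDiff_averagedTaylorSum hB (hb.subset hBΥ) fun α hα =>
      hu.integrableOn_weakDeriv hΥ hb hBΥ i hα.le).continuous)

/-- The approximation estimate for one derivative of one component. -/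
lemma MemH.integral_sq_weakDeriv_sub_le (hΥ : IsOpen Υ) (hb : Bornology.IsBounded Υ)
    (hu : MemH Υ m u) {y : E N} {ρ : ℝ} (hd : 0 < Metric.diam Υ) (hρ : 0 < ρ) (hρ1 : ρ < 1)
    (hstar : StarShapedWrt Υ (Metric.ball y (ρ * Metric.diam Υ))) (i : Fin N') {j : ℕ}
    (hj : j < m) {α : MultiIndex N} (hα : MultiIndex.length α = j) :
    ∫ x in Υ, (weakDeriv Υ α
        ((u - averagedTaylor Υ (Metric.ball y (ρ * Metric.diam Υ)) m u) i) x) ^ 2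
      ≤ ((N : ℝ) ^ (m - j) / (m - j - 1)! * Metric.diam Υ ^ (m - j)) ^ 2 * (ρ ^ N)⁻¹ *
        ∑ γ ∈ multiIndices N m, ∫ x in Υ, (weakDeriv Υ γ (u i) x) ^ 2 := by
  set B := Metric.ball y (ρ * Metric.diam Υ) with hB
  have hα' : MultiIndex.length α ≤ m := by omega
  have h1 := (hu.hasWeakDeriv_sub_averagedTaylor hΥ hb (measurableSet_ball (x := y)) hstar.1 i
    hα').weakDeriv_ae_eq hΥ
  have hlen : ∀ β, MultiIndex.length β ≤ m - j → MultiIndex.length (β + α) ≤ m := by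
    intro β hβ
    rw [MultiIndex.length_add]
    omega
  have h2 := integral_sq_sub_averagedTaylorSum_le (n := m - j)
    (f := fun β => weakDeriv Υ (β + α) (u i)) (by omega) hΥ hb
    (fun β hβ => hu.memLp_weakDeriv hΥ (hlen β hβ) i)
    (fun β hβ k η hη => by
      have e : β + Pi.single k 1 + α = β + α + Pi.single k 1 := add_right_comm _ _ _
      rw [e]
      refine (hu.hasWeakDeriv (hlen β hβ.le) i).integral_mul_partialDeriv
        (hu.hasWeakDeriv ?_ i) hη
      rw [← e]
      refine hlen _ ?_
      rw [MultiIndex.length_add, MultiIndex.length_single]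
      omega) hd hρ hρ1 hstar
  have h3 : ∫ x in Υ, (weakDeriv Υ α ((u - averagedTaylor Υ B m u) i) x) ^ 2
      = ∫ x in Υ, (weakDeriv Υ (0 + α) (u i) x - averagedTaylorSum B (m - j)
        (fun β => weakDeriv Υ (β + α) (u i)) x) ^ 2 := by
    refine integral_congr_ae ?_
    filter_upwards [h1] with x hx
    rw [hx, hα, zero_add, Pi.sub_apply]
  rw [h3]
  refine h2.trans (mul_le_mul_of_nonneg_left ?_ (by positivity))
  -- The derivatives `D^{β+α} u` with `|β| = m - j` are distinct derivatives of order `m`, so their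
  -- sum is part of the full sum.
  have hinj : Set.InjOn (fun β : MultiIndex N => β + α) (multiIndices N (m - j)) :=
    fun a _ b _ hab => add_right_cancel hab
  rw [← Finset.sum_image (f := fun γ => ∫ x in Υ, (weakDeriv Υ γ (u i) x) ^ 2)
    (g := fun β : MultiIndex N => β + α) hinj]
  refine Finset.sum_le_sum_of_subset_of_nonneg (fun γ hγ => ?_)
    fun γ _ _ => integral_nonneg fun x => sq_nonneg _
  obtain ⟨β, hβ, rfl⟩ := Finset.mem_image.1 hγ
  rw [mem_multiIndices] at hβ ⊢
  rw [MultiIndex.length_add]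
  omega

theorem MemH.seminormH_sub_averagedTaylor_le (hN : 1 ≤ N) (hΥ : IsOpen Υ)
    (hb : Bornology.IsBounded Υ)
    (hu : MemH Υ m u) {y : E N} {ρ : ℝ} (hd : 0 < Metric.diam Υ) (hρ : 0 < ρ) (hρ1 : ρ < 1)
    (hstar : StarShapedWrt Υ (Metric.ball y (ρ * Metric.diam Υ))) {j : ℕ} (hj : j < m) :
    seminormH Υ j (u - averagedTaylor Υ (Metric.ball y (ρ * Metric.diam Υ)) m u) ≤
      2 * ((N + j - 1).choose (N - 1) : ℝ) * ((N : ℝ) ^ (m - j) / ((m - j - 1)! : ℝ))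
        * (Metric.diam Υ ^ (m - j) / ρ ^ ((N : ℝ) / 2)) * seminormH Υ m u := by
  set c : ℝ := ((N + j - 1).choose (N - 1) : ℝ) with hc
  have hc1 : 1 ≤ c := by
    have : 0 < (N + j - 1).choose (N - 1) := Nat.choose_pos (by omega)
    rw [hc]
    exact_mod_cast this
  set S : ℝ := ∑ i, ∑ γ ∈ multiIndices N m, ∫ x in Υ, (weakDeriv Υ γ (u i) x) ^ 2 with hS
  have hS0 : 0 ≤ S := Finset.sum_nonneg fun i _ => Finset.sum_nonneg fun γ _ =>
    integral_nonneg fun x => sq_nonneg _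
  set A : ℝ := (N : ℝ) ^ (m - j) / ((m - j - 1)! : ℝ) with hA
  have hA0 : 0 ≤ A := by positivity
  have h1 : ∑ i, ∑ α ∈ multiIndices N j, ∫ x in Υ, (weakDeriv Υ α
      ((u - averagedTaylor Υ (Metric.ball y (ρ * Metric.diam Υ)) m u) i) x) ^ 2
      ≤ c * ((A * Metric.diam Υ ^ (m - j)) ^ 2 * (ρ ^ N)⁻¹ * S) := by
    calc _ ≤ ∑ i, ∑ _α ∈ multiIndices N j, (A * Metric.diam Υ ^ (m - j)) ^ 2 * (ρ ^ N)⁻¹ *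
          ∑ γ ∈ multiIndices N m, ∫ x in Υ, (weakDeriv Υ γ (u i) x) ^ 2 :=
          Finset.sum_le_sum fun i _ => Finset.sum_le_sum fun α hα =>
            hu.integral_sq_weakDeriv_sub_le hΥ hb hd hρ hρ1 hstar i hj (mem_multiIndices.1 hα)
      _ = _ := by
          simp only [Finset.sum_const, nsmul_eq_mul, card_multiIndices hN]
          rw [← Finset.mul_sum, ← Finset.mul_sum]
  have hρ2 : (ρ ^ ((N : ℝ) / 2)) ^ 2 = ρ ^ N := by
    rw [← Real.rpow_natCast, ← Real.rpow_mul hρ.le, ← Real.rpow_natCast]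
    norm_num
  unfold seminormH
  refine Real.sqrt_le_iff.2 ⟨by positivity, h1.trans ?_⟩
  have e : (2 * c * A * (Metric.diam Υ ^ (m - j) / ρ ^ ((N : ℝ) / 2)) * √S) ^ 2
      = (2 * c) ^ 2 * ((A * Metric.diam Υ ^ (m - j)) ^ 2 * (ρ ^ N)⁻¹ * S) := by
    rw [mul_pow, mul_pow, mul_pow (2 * c), div_pow (Metric.diam Υ ^ (m - j)), hρ2, Real.sq_sqrt hS0]
    ring
  rw [e]
  refine mul_le_mul_of_nonneg_right ?_ (by positivity)
  -- With `c` multi-indices of length `j`, the argument gives the factor `√c`; as `c ≥ 1`, this is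
  -- at most `2 * c`.
  nlinarith

end Seminorm

end AveragedTaylor

/-! ### The main theorem -/

open AveragedTaylor in
theorem mainTheorem10 {N N' N'' : ℕ} (hN : 2 ≤ N)
    (Υ : Set (E N)) (hΥ_open : IsOpen Υ) (hΥ_bdd : Bornology.IsBounded Υ)
    (h : ℝ) (hh : h = Metric.diam Υ)
    (y : E N) (hy : y ∈ Υ) (ρ : ℝ) (hρ_pos : 0 < ρ) (hρ_le : ρ ≤ 1 / 2)
    (B : Set (E N)) (hB : B = Metric.ball y (ρ * h)) (hstar : StarShapedWrt Υ B)
    (d : ℕ) (a : MultiIndex N → Fin N' → Fin N'' → ℝ)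
    (u : Fin N' → E N → ℝ) (hu : MemL2 Υ u) (hsol : IsDistribSolution Υ d a u)
    (m : ℕ) (hm : 1 ≤ m) :
    -- Taylor polynomials of classically differentiable solutions
    ((∀ i, ContDiffOn ℝ (m - 1 : ℕ) (u i) Υ) → ∀ z ∈ Υ,
      (∀ i, IsPolyOfDegreeLE (m - 1) (taylorPoly m u z i)) ∧
      ∀ i'' x, diffOp d a (taylorPoly m u z) i'' x = 0) ∧
    -- averaged Taylor polynomials of Sobolev solutions
    (MemH Υ (m - 1) u →
      (∀ i x, IntegrableOn (fun z => taylorSum m (fun α => weakDeriv Υ α (u i)) z x) B) ∧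
      (∀ i, IsPolyOfDegreeLE (m - 1) (averagedTaylor Υ B m u i)) ∧
      ∀ i'' x, diffOp d a (averagedTaylor Υ B m u) i'' x = 0) ∧
    -- the approximation estimate
    (MemH Υ m u →
      MemH Υ m (u - averagedTaylor Υ B m u) ∧
      ∀ j : ℕ, j ≤ m - 1 →
        seminormH Υ j (u - averagedTaylor Υ B m u) ≤
          2 * ((N + j - 1).choose (N - 1) : ℝ) * ((N : ℝ) ^ (m - j) / ((m - j - 1)! : ℝ))
            * (h ^ (m - j) / ρ ^ ((N : ℝ) / 2)) * seminormH Υ m u) := by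
  have hBm : MeasurableSet B := hB ▸ measurableSet_ball
  have hBb : Bornology.IsBounded B := hΥ_bdd.subset hstar.1
  refine ⟨fun hu z hz => ⟨fun i => isPolyOfDegreeLE_taylorSum _ _ _,
    fun i'' x => diffOp_taylorPoly_eq_zero hΥ_open hsol hu hz i'' x⟩, fun hu => ?_, fun hu => ?_⟩
  · have hint : ∀ i α, MultiIndex.length α < m → IntegrableOn (weakDeriv Υ α (u i)) B :=
      fun i α hα => hu.integrableOn_weakDeriv hΥ_open hΥ_bdd hstar.1 i (by omega)
    exact ⟨fun i x => integrableOn_taylorSum hBm hBb (hint i) x,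
      fun i => isPolyOfDegreeLE_averagedTaylorSum hBm hBb (hint i),
      fun i'' x => diffOp_averagedTaylor_eq_zero hΥ_open hΥ_bdd hsol hm hu hBm hstar.1 i'' x⟩
  · refine ⟨hu.sub_averagedTaylor hΥ_open hΥ_bdd hBm hstar.1, fun j hj => ?_⟩
    subst hh hB
    exact hu.seminormH_sub_averagedTaylor_le (by omega) hΥ_open hΥ_bdd
      (diam_pos_of_isOpen (by omega) hΥ_open hΥ_bdd hy) hρ_pos (by linarith) hstar (by omega)
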